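/- Let $X$ be the surface of the regular octahedron with edge length $\sqrt3$, with its intrinsic metric $d_X$ (the infimum of the lengths of paths on the surface), and let $A:X\to X$ be the antipodal map. For $p\in X$ let $\mathcal F_p\subset X$ be the set of points $q$ that maximize $d_X(p,q)$. Let $X'$ be the set of $p$ such that $\mathcal F_p$ is a single point, and for $p\in X'$ let $F(p)$ be this point. Put $X^{(1)}=X'$, $X^{(n+1)}=\{p\in X' : F(p)\in X^{(n)}\}$ and $X^{(\infty)}=\bigcap_{n\ge1}X^{(n)}$, the set where the full forward orbit is defined. Let $f=A\circ F$, and let $L_\infty(f)$ be the set of points $p\in X$ such that $\lim_{n\to\infty}f^n(q)=p$ for some $q\in X^{(\infty)}$. Identify one face of $X$ isometrically with the planar triangle whose vertices are the three cube roots of unity, and let $T$ be the closed triangle in this face with vertices $(0,0)$, $(1,0)$ and $\left(\frac14,\frac{\sqrt3}{4}\right)$; it is a fundamental domain for the isometry group of $X$. Let $\partial_\infty T$ be the union of the two non-horizontal sides of $T$. Let $r\approx 0.239123$ be the root of $x^3-x^2-4x+1$ in $\left(0,\frac14\right)$, and let $J\subset T$ be the graph of $$y=\frac1{\sqrt3}\left(1-x-\bigl((2+x)(5-2x)(1-4x)\bigr)^{1/3}\right),\qquad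 r\le x<\tfrac14 .$$ Then: 1. $X'\cap T=X^{(\infty)}\cap T=T-J$. 2. For $p\in T-J$, $f(p)=p$ if and only if $p\in\partial_\infty T$. 3. $L_\infty(f)\cap T=\partial_\infty T$. -/

import Mathlib

open Filter Topology
open scoped ENNReal

namespace Farpoint

/-! ### The farpoint map of a space `X` with an (extended) distance function `d` -/

section General

variable {X : Type*} (d : X → X → ℝ≥0∞)

/-- The set `ℱ_p` of points `q` which maximize `q ↦ d p q`. -/
def farthestSet (p : X) : Set X := {q | ∀ q', d p q' ≤ d p q}

/-- The set `X'` of points `p` such that `ℱ_p` is a single point. -/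
def uniqueFarSet : Set X := {p | ∃ q, farthestSet d p = {q}}

open Classical in
/-- The farpoint map: for `p ∈ X'`, `F p` is the unique member of `ℱ_p`.
Off `X'`, where the map is undefined, it is given the irrelevant value `p`. -/
noncomputable def farpointMap (p : X) : X :=
  if h : ∃ q, farthestSet d p = {q} then h.choose else p

/-- `orbitDomain d n` is `X^(n+1)`: `X^(1) = X'`, and `X^(n+1)` is the set of those `p ∈ X'`
with `F p ∈ X^(n)`. -/
def orbitDomain : ℕ → Set X
  | 0 => uniqueFarSet d
  | n + 1 => {p | p ∈ uniqueFarSet d ∧ farpointMap d p ∈ orbitDomain n}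

/-- The set `X^(∞)`, the intersection of all `X^(n)`, on which the full forward orbit is
defined. -/
def fullOrbitDomain : Set X := ⋂ n : ℕ, orbitDomain d n

end General

/-! ### The regular octahedron with its intrinsic metric -/

/-- The surface of the regular octahedron, scaled so that its edges have length `√3`. -/
def octahedronSurface : Set (EuclideanSpace ℝ (Fin 3)) :=
  {v | |v 0| + |v 1| + |v 2| = √(3 / 2)}

/-- The octahedron `X`, as a space. -/
abbrev Octahedron : Type := octahedronSurface

/-- The Euclidean length of a path on the octahedron. -/
noncomputable def pathLength {p q : Octahedron} (γ : Path p q) : ℝ≥0∞ :=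
  eVariationOn (fun t => (γ t : EuclideanSpace ℝ (Fin 3))) Set.univ

/-- The intrinsic metric: the infimum of the lengths of the paths on the surface. -/
noncomputable def surfaceDist (p q : Octahedron) : ℝ≥0∞ := ⨅ γ : Path p q, pathLength γ

/-- The antipodal map. -/
def antipode (p : Octahedron) : Octahedron :=
  ⟨-p.1, by
    have h := p.2
    simp only [octahedronSurface, Set.mem_ofPred_eq, PiLp.neg_apply, abs_neg] at h ⊢
    exact h⟩

/-- The map `f = A ∘ F`; it is meaningful on `X'`. -/
noncomputable def f (p : Octahedron) : Octahedron := antipode (farpointMap surfaceDist p)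

/-- `L_∞(f)`: the set of all limits (in the intrinsic metric) of sequences `fⁿ(q)`, where `q` is
a point whose full forward orbit is defined. -/
def limitSet : Set Octahedron :=
  {p | ∃ q ∈ fullOrbitDomain surfaceDist,
    Tendsto (fun n : ℕ => surfaceDist (f^[n] q) p) atTop (𝓝 0)}

/-! ### The fundamental domain `T`, its sides, and the curve `J` -/

/-- The isometric affine map of the plane to 3-space which sends the cube roots of unity
`(1, 0)`, `(-1/2, √3/2)`, `(-1/2, -√3/2)` to the vertices `(c, 0, 0)`, `(0, c, 0)`, `(0, 0, c)` of
the octahedron, where `c = √(3/2)`. It identifies the triangle spanned by the cube roots of unity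
with a face. -/
noncomputable def chart (z : ℝ × ℝ) : EuclideanSpace ℝ (Fin 3) :=
  √(3 / 2) • !₂[(1 + 2 * z.1) / 3, (1 - z.1) / 3 + z.2 / √3, (1 - z.1) / 3 - z.2 / √3]

/-- The subset of the octahedron with local coordinates in `S`. -/
def onOctahedron (S : Set (ℝ × ℝ)) : Set Octahedron := Subtype.val ⁻¹' (chart '' S)

/-- The fundamental triangle, in local coordinates. -/
def planeT : Set (ℝ × ℝ) := convexHull ℝ {(0, 0), (1, 0), (1 / 4, √3 / 4)}

/-- The union of the two non-horizontal sides of the triangle, in local coordinates. -/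
def planeSides : Set (ℝ × ℝ) :=
  segment ℝ (0, 0) (1 / 4, √3 / 4) ∪ segment ℝ (1, 0) (1 / 4, √3 / 4)

/-- The curve `J` in local coordinates: a graph over `[r, 1/4)`, where `r ≈ 0.239123` is the root of
`x³ - x² - 4x + 1` in `(0, 1/4)`. -/
def planeJ : Set (ℝ × ℝ) :=
  {z | ∃ r : ℝ, 0 < r ∧ r < 1 / 4 ∧ r ^ 3 - r ^ 2 - 4 * r + 1 = 0 ∧ r ≤ z.1 ∧ z.1 < 1 / 4 ∧
    z.2 = 1 / √3 *
      (1 - z.1 - ((2 + z.1) * (5 - 2 * z.1) * (1 - 4 * z.1)) ^ (1 / 3 : ℝ))}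

/-- The fundamental domain `T`. -/
def T : Set Octahedron := onOctahedron planeT

/-- The union `∂_∞ T` of the two non-horizontal sides of `T`. -/
def sidesT : Set Octahedron := onOctahedron planeSides

/-- The curve `J`. -/
def J : Set Octahedron := onOctahedron planeJ

end Farpoint

namespace Farpoint

/-! ### Transporting data along a path covered by finitely many closed sets -/

/-! Write points of the face of T in the coordinates x and Y = √3 y, and fix p = (x, Y) in T.
Distances to the opposite face are computed by unfolding. After its last visit to the closed face of
p, a path to the opposite face crosses the band of six remaining faces, whose universal cover is a
plane strip. Unfolding the two end faces along the edges that are crossed bounds the length below by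
a plane distance. The unfoldings that matter are the six strips of four consecutive faces; each is a
parallelogram, so its segments roll up to paths on the surface (`surfaceDist_rollUp_le`). Hence the
distance is the minimum of six explicit expressions, paired by an absolute value
(`le_surfaceDist_opposite`, `surfaceDist_le_opposite_mid`).

Let the target be the antipode of (x + e, Y + n). For n = 0 one unfolding has squared length (2x + e
- 1/2)² + 27/4, which is convex in e. A second one equals it at e = `stepRight` ≥ 0 and at e =
`stepLeft` ≤ 0. Between these values only the two ends can be farthest; beyond them, or for n ≠ 0,
some unfolding is strictly shorter (`lt_or_eq_of_inFace`). Points off the opposite face are nearer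
too (`surfaceDist_lt_of_not_opposite`). The two candidates differ in squared distance by a positive
multiple of (3x - Y)(1 - x - Y) `curveJ` (`heightSq_sub`). The product vanishes exactly on the two
non-horizontal sides, where both steps are zero and the candidates coincide; elsewhere `curveJ` = 0
is the curve J, where two distinct points tie.

So off J the map f is a horizontal move by `stepRight` or `stepLeft`. Since `curveJ` increases with
x, an orbit stays on its side of J and never stops being defined. A step is zero only on the sides,
and the steps of a convergent orbit tend to zero, so its limit lies on the sides; conversely points
of the sides are fixed. Starting points outside T are moved into T by a symmetry, and a symmetry
taking a point of T into T fixes that point. -/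

theorem exists_edist_le_eVariationOn {E V ι : Type*} [PseudoEMetricSpace E] [PseudoEMetricSpace V]
    {γ : ℝ → E} {C : ι → Set E} {Q : E → V → Prop} {t : ℝ} (S : Finset ι)
    (hC : ∀ i ∈ S, IsClosed (C i))
    (hQ : ∀ i ∈ S, ∀ x ∈ C i, ∀ y ∈ C i, ∀ v, Q x v → ∃ w, Q y w ∧ edist v w ≤ edist x y) :
    ∀ s ≤ t, ContinuousOn γ (Set.Icc s t) → (∀ τ ∈ Set.Icc s t, ∃ i ∈ S, γ τ ∈ C i) →
      ∀ v, Q (γ s) v → ∃ w, Q (γ t) w ∧ edist v w ≤ eVariationOn γ (Set.Icc s t) := by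
  classical
  induction S using Finset.strongInduction with
  | H S ih =>
    intro s hst hγ hcov v hv
    obtain ⟨i, hi, hsi⟩ := hcov s ⟨le_rfl, hst⟩
    have hK : IsCompact (Set.Icc s t ∩ γ ⁻¹' C i) :=
      isCompact_Icc.of_isClosed_subset
        (hγ.preimage_isClosed_of_isClosed isClosed_Icc (hC i hi)) Set.inter_subset_left
    -- The last time in `C i`: a single comparison inside `C i` covers everything before it, however
    -- often the path leaves and returns, and afterwards the index `i` is no longer needed.
    obtain ⟨t₁, ⟨ht₁, ht₁i⟩, hmax⟩ := hK.exists_isGreatest ⟨s, ⟨le_rfl, hst⟩, hsi⟩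
    obtain ⟨w, hw, hvw⟩ := hQ i hi _ hsi _ ht₁i v hv
    have hvw' : edist v w ≤ eVariationOn γ (Set.Icc s t₁) :=
      hvw.trans (eVariationOn.edist_le _ ⟨le_rfl, ht₁.1⟩ ⟨ht₁.1, le_rfl⟩)
    rcases ht₁.2.eq_or_lt with h | hlt
    · subst h; exact ⟨w, hw, hvw'⟩
    have hsub : Set.Icc t₁ t ⊆ Set.Icc s t := Set.Icc_subset_Icc_left ht₁.1
    have hcov' : ∀ τ ∈ Set.Ioc t₁ t, ∃ j ∈ S.erase i, γ τ ∈ C j := by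
      intro τ hτ
      obtain ⟨j, hj, hτj⟩ := hcov τ (hsub ⟨hτ.1.le, hτ.2⟩)
      refine ⟨j, Finset.mem_erase.2 ⟨?_, hj⟩, hτj⟩
      rintro rfl
      exact absurd (hmax ⟨hsub ⟨hτ.1.le, hτ.2⟩, hτj⟩) (not_le.2 hτ.1)
    have hcl : IsClosed (⋃ j ∈ S.erase i, C j) :=
      Set.Finite.isClosed_biUnion (S.erase i).finite_toSet
        (fun j hj => hC j (Finset.mem_of_mem_erase hj))
    -- The remaining sets cover the path only after `t₁`; as their union is closed, it also contains
    -- the point at `t₁`.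
    have hend : γ t₁ ∈ ⋃ j ∈ S.erase i, C j := by
      have hcont : ContinuousWithinAt γ (Set.Ioc t₁ t) t₁ :=
        (hγ t₁ ht₁).mono (Set.Ioc_subset_Icc_self.trans hsub)
      refine hcl.closure_subset (hcont.mem_closure (t := ⋃ j ∈ S.erase i, C j) ?_ ?_)
      · rw [closure_Ioc hlt.ne]; exact ⟨le_rfl, hlt.le⟩
      · intro τ hτ
        simpa using hcov' τ hτ
    obtain ⟨w', hw', hww'⟩ := ih (S.erase i) (Finset.erase_ssubset hi)
      (fun j hj => hC j (Finset.mem_of_mem_erase hj))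
      (fun j hj => hQ j (Finset.mem_of_mem_erase hj)) t₁ hlt.le (hγ.mono hsub)
      (by
        intro τ hτ
        rcases hτ.1.eq_or_lt with h | h
        · subst h; simpa using hend
        · exact hcov' τ ⟨h, hτ.2⟩) w hw
    refine ⟨w', hw', (edist_triangle v w w').trans ?_⟩
    have := eVariationOn.Icc_add_Icc γ (s := Set.univ) ht₁.1 ht₁.2 (Set.mem_univ _)
    simp only [Set.univ_inter] at this
    rw [← this]
    exact add_le_add hvw' hww'

/-! ### Elementary properties of the intrinsic distance -/

theorem pathLength_eq {p q : Octahedron} (γ : Path p q) :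
    pathLength γ =
      eVariationOn (fun t => (γ.extend t : EuclideanSpace ℝ (Fin 3))) (Set.Icc 0 1) := by
  have h := eVariationOn.comp_eq_of_monotoneOn
    (fun t => (γ.extend t : EuclideanSpace ℝ (Fin 3))) (t := (Set.univ : Set unitInterval))
    Subtype.val (fun a _ b _ hab => hab)
  rw [Set.image_univ, Subtype.range_coe] at h
  rw [pathLength, ← unitInterval, ← h]
  congr 1
  funext t
  simp

theorem edist_le_surfaceDist (p q : Octahedron) :
    edist (p : EuclideanSpace ℝ (Fin 3)) q ≤ surfaceDist p q := by
  refine le_iInf fun γ => ?_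
  have := eVariationOn.edist_le (fun t => (γ t : EuclideanSpace ℝ (Fin 3)))
    (Set.mem_univ (0 : unitInterval)) (Set.mem_univ 1)
  simpa [pathLength] using this

theorem surfaceDist_map_le {G : Octahedron → Octahedron} (hG : LipschitzWith 1 G)
    (p q : Octahedron) : surfaceDist (G p) (G q) ≤ surfaceDist p q := by
  refine le_iInf fun γ => (iInf_le _ (γ.map hG.continuous)).trans ?_
  have := (hG.lipschitzOnWith (s := Set.univ)).comp_eVariationOn_le (g := fun t => γ t)
    (s := Set.univ) (fun _ _ => Set.mem_univ _)
  simpa [pathLength, eVariationOn, Subtype.edist_eq, Function.comp_def] using this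

theorem surfaceDist_isometryEquiv (G : Octahedron ≃ᵢ Octahedron) (p q : Octahedron) :
    surfaceDist (G p) (G q) = surfaceDist p q := by
  refine le_antisymm (surfaceDist_map_le G.isometry.lipschitz p q) ?_
  simpa using surfaceDist_map_le G.symm.isometry.lipschitz (G p) (G q)

theorem eVariationOn_Icc_le_of_lipschitzOnWith {E : Type*} [PseudoEMetricSpace E] {K : NNReal}
    {g : ℝ → E} (hg : LipschitzOnWith K g (Set.Icc 0 1)) :
    eVariationOn g (Set.Icc 0 1) ≤ K := by
  have h := hg.comp_eVariationOn_le (g := fun t : ℝ => t) (s := Set.Icc 0 1) (fun _ ht => ht)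
  have h1 : eVariationOn (fun t : ℝ => t) (Set.Icc 0 1) ≤ 1 := by
    have h := ((monotone_id (α := ℝ)).monotoneOn (Set.Icc 0 1)).eVariationOn_eq
      (a := (0 : ℝ)) (b := 1) (by simp) (by simp)
    rw [Set.inter_self] at h
    exact h.le.trans (by simp)
  refine h.trans ?_
  calc (K : ℝ≥0∞) * eVariationOn (fun t : ℝ => t) (Set.Icc 0 1) ≤ K * 1 := by gcongr
    _ = K := mul_one _

/-- A map which is `1`-Lipschitz on each of finitely many closed pieces of a convex set of
the plane does not increase distances. -/
theorem surfaceDist_le_of_pieces {ι : Type*} {Ψ : ℂ → Octahedron} {K : Set ℂ} (hK : Convex ℝ K)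
    {C : ι → Set ℂ} (S : Finset ι) (hC : ∀ i ∈ S, IsClosed (C i))
    (hcov : ∀ u ∈ K, ∃ i ∈ S, u ∈ C i)
    (hΨ : ∀ i ∈ S, ∀ u ∈ C i, ∀ v ∈ C i, edist (Ψ u) (Ψ v) ≤ edist u v)
    {u v : ℂ} (hu : u ∈ K) (hv : v ∈ K) : surfaceDist (Ψ u) (Ψ v) ≤ edist u v := by
  -- Transport along a segment with the relation `y = Ψ x` glues the pieces: `Ψ` becomes 1-Lipschitz
  -- on all of `K`, whose convexity keeps the segment inside the cover.
  have key : ∀ a ∈ K, ∀ b ∈ K, edist (Ψ a) (Ψ b) ≤ edist a b := by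
    intro a ha b hb
    set γ : ℝ → ℂ := fun t => AffineMap.lineMap a b t
    have hγ : LipschitzWith (nndist a b) γ := by
      simpa using
        (lipschitzWith_lineMap a b : LipschitzWith (nndist a b) (AffineMap.lineMap a b : ℝ → ℂ))
    obtain ⟨w, rfl, hw⟩ := exists_edist_le_eVariationOn (γ := γ) (Q := fun x y => y = Ψ x)
      (t := 1) S hC
      (fun i hi x hx y hy v hv => ⟨Ψ y, rfl, hv ▸ hΨ i hi x hx y hy⟩) 0 zero_le_one
      hγ.continuous.continuousOn
      (fun τ hτ => hcov _ (hK.lineMap_mem ha hb hτ)) _ rfl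
    simp only [γ, AffineMap.lineMap_apply_zero, AffineMap.lineMap_apply_one] at hw
    refine hw.trans ?_
    refine (eVariationOn_Icc_le_of_lipschitzOnWith hγ.lipschitzOnWith).trans ?_
    rw [edist_nndist]
  have hΓ : LipschitzOnWith (nndist u v) (fun t : ℝ => Ψ (AffineMap.lineMap u v t))
      (Set.Icc 0 1) := by
    intro s hs t ht
    refine (key _ (hK.lineMap_mem hu hv hs) _ (hK.lineMap_mem hu hv ht)).trans ?_
    exact (lipschitzWith_lineMap u v :
      LipschitzWith (nndist u v) (AffineMap.lineMap u v : ℝ → ℂ)) s t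
  let γ : Path (Ψ u) (Ψ v) :=
    { toFun := fun t => Ψ (AffineMap.lineMap u v (t : ℝ))
      continuous_toFun := hΓ.continuousOn.domRestrict
      source' := by simp
      target' := by simp }
  refine (iInf_le _ γ).trans ?_
  have h2 : LipschitzOnWith (nndist u v)
      (fun t => (γ.extend t : EuclideanSpace ℝ (Fin 3))) (Set.Icc 0 1) := by
    intro s hs t ht
    have h := hΓ hs ht
    simp only [Path.extend_apply _ hs, Path.extend_apply _ ht]
    exact h
  rw [pathLength_eq, edist_nndist]
  exact eVariationOn_Icc_le_of_lipschitzOnWith h2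

/-! ### Normalised coordinates -/

/-- The point of 3-space with coordinates `a`, `b`, `d`, in the unit in which the octahedron is
the unit sphere of the `ℓ¹` norm. -/
noncomputable def vec (a b d : ℝ) : EuclideanSpace ℝ (Fin 3) := √(3 / 2) • !₂[a, b, d]

@[simp] theorem vec_zero (a b d : ℝ) : vec a b d 0 = √(3 / 2) * a := by simp [vec]
@[simp] theorem vec_one (a b d : ℝ) : vec a b d 1 = √(3 / 2) * b := by simp [vec]
@[simp] theorem vec_two (a b d : ℝ) : vec a b d 2 = √(3 / 2) * d := by simp [vec]

theorem sqrt_three_halves_pos : 0 < √(3 / 2 : ℝ) := by positivity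

theorem vec_inj {a b d a' b' d' : ℝ} : vec a b d = vec a' b' d' ↔ a = a' ∧ b = b' ∧ d = d' := by
  constructor
  · intro h
    have h0 := congrArg (fun v => v 0) h
    have h1 := congrArg (fun v => v 1) h
    have h2 := congrArg (fun v => v 2) h
    have hc := sqrt_three_halves_pos.ne'
    simp only [vec_zero, vec_one, vec_two] at h0 h1 h2
    exact ⟨mul_left_cancel₀ hc h0, mul_left_cancel₀ hc h1, mul_left_cancel₀ hc h2⟩
  · rintro ⟨rfl, rfl, rfl⟩; rfl

theorem exists_vec (v : EuclideanSpace ℝ (Fin 3)) : ∃ a b d, v = vec a b d := by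
  have hc := sqrt_three_halves_pos.ne'
  refine ⟨v 0 / √(3 / 2), v 1 / √(3 / 2), v 2 / √(3 / 2), ?_⟩
  ext i
  fin_cases i
  · change v 0 = vec _ _ _ 0
    rw [vec_zero]; field_simp
  · change v 1 = vec _ _ _ 1
    rw [vec_one]; field_simp
  · change v 2 = vec _ _ _ 2
    rw [vec_two]; field_simp

theorem vec_mem_iff {a b d : ℝ} : vec a b d ∈ octahedronSurface ↔ |a| + |b| + |d| = 1 := by
  have hc := sqrt_three_halves_pos
  change |vec a b d 0| + |vec a b d 1| + |vec a b d 2| = √(3 / 2) ↔ _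
  rw [vec_zero, vec_one, vec_two, abs_mul, abs_mul, abs_mul, abs_of_pos hc, ← mul_add, ← mul_add]
  constructor
  · intro h
    exact mul_left_cancel₀ hc.ne' (h.trans (mul_one _).symm)
  · intro h
    rw [h, mul_one]

theorem dist_vec (a b d a' b' d' : ℝ) : dist (vec a b d) (vec a' b' d') =
    √(3 / 2 * ((a - a') ^ 2 + (b - b') ^ 2 + (d - d') ^ 2)) := by
  rw [EuclideanSpace.dist_eq, Fin.sum_univ_three]
  simp only [vec_zero, vec_one, vec_two, Real.dist_eq, sq_abs, ← mul_sub, mul_pow]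
  rw [Real.sq_sqrt (by norm_num)]
  congr 1; ring

/-- The point of the octahedron with normalised coordinates `a`, `b`, `d`. -/
noncomputable def oct (a b d : ℝ) (h : |a| + |b| + |d| = 1) : Octahedron :=
  ⟨vec a b d, vec_mem_iff.2 h⟩

theorem oct_inj {a b d a' b' d' : ℝ} {h h'} :
    oct a b d h = oct a' b' d' h' ↔ a = a' ∧ b = b' ∧ d = d' := by
  rw [oct, oct, Subtype.mk.injEq, vec_inj]

theorem exists_oct (p : Octahedron) : ∃ a b d, ∃ h : |a| + |b| + |d| = 1, p = oct a b d h := by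
  obtain ⟨v, hv⟩ := p
  obtain ⟨a, b, d, rfl⟩ := exists_vec v
  exact ⟨a, b, d, vec_mem_iff.1 hv, rfl⟩

theorem neg_vec (a b d : ℝ) : -vec a b d = vec (-a) (-b) (-d) := by
  ext i
  fin_cases i <;> simp [vec]

theorem antipode_oct (a b d : ℝ) (h) :
    antipode (oct a b d h) = oct (-a) (-b) (-d) (by simpa using h) :=
  Subtype.ext (neg_vec a b d)

/-! ### Symmetries -/

/-- The linear symmetry of the octahedron given by a permutation of the coordinates and changes
of sign. -/
noncomputable def signedPerm (π : Equiv.Perm (Fin 3)) (ε : Fin 3 → ℤˣ) :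
    Octahedron ≃ᵢ Octahedron where
  toFun p := ⟨WithLp.toLp 2 fun i => ((ε i : ℤ) : ℝ) * p.1 (π i), by
    have h : ∑ i, |p.1 i| = √(3 / 2) := by rw [Fin.sum_univ_three]; exact p.2
    have h' := (Equiv.sum_comp π fun i => |p.1 i|).trans h
    rw [Fin.sum_univ_three] at h'
    change |_ * _| + |_ * _| + |_ * _| = _
    have hε : ∀ i, |((ε i : ℤ) : ℝ)| = 1 := fun i => by
      rcases Int.units_eq_one_or (ε i) with h | h <;> simp [h]
    simpa [abs_mul, hε] using h'⟩
  invFun p := ⟨WithLp.toLp 2 fun i => ((ε (π.symm i) : ℤ) : ℝ) * p.1 (π.symm i), by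
    have h : ∑ i, |p.1 i| = √(3 / 2) := by rw [Fin.sum_univ_three]; exact p.2
    have h' := (Equiv.sum_comp π.symm fun i => |p.1 i|).trans h
    rw [Fin.sum_univ_three] at h'
    change |_ * _| + |_ * _| + |_ * _| = _
    have hε : ∀ i, |((ε i : ℤ) : ℝ)| = 1 := fun i => by
      rcases Int.units_eq_one_or (ε i) with h | h <;> simp [h]
    simpa [abs_mul, hε] using h'⟩
  left_inv p := by
    apply Subtype.ext
    ext i
    rcases Int.units_eq_one_or (ε (π.symm i)) with h | h <;> simp [h]
  right_inv p := by
    apply Subtype.ext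
    ext i
    rcases Int.units_eq_one_or (ε i) with h | h <;> simp [h]
  isometry_toFun := by
    refine Isometry.of_dist_eq fun p q => ?_
    rw [Subtype.dist_eq, Subtype.dist_eq, EuclideanSpace.dist_eq, EuclideanSpace.dist_eq]
    congr 1
    rw [← Equiv.sum_comp π fun i => dist (p.1 i) (q.1 i) ^ 2]
    refine Finset.sum_congr rfl fun i _ => ?_
    rcases Int.units_eq_one_or (ε i) with h | h <;> simp [h, dist_neg_neg]

theorem signedPerm_apply (π : Equiv.Perm (Fin 3)) (ε : Fin 3 → ℤˣ) (p : Octahedron) (i : Fin 3) :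
    (signedPerm π ε p).1 i = ((ε i : ℤ) : ℝ) * p.1 (π i) := rfl

theorem signedPerm_antipode (π : Equiv.Perm (Fin 3)) (ε : Fin 3 → ℤˣ) (p : Octahedron) :
    signedPerm π ε (antipode p) = antipode (signedPerm π ε p) := by
  apply Subtype.ext
  ext i
  simp [signedPerm_apply, antipode]

theorem antipode_eq_signedPerm (p : Octahedron) : antipode p = signedPerm 1 (fun _ => -1) p := by
  apply Subtype.ext
  ext i
  simp [signedPerm_apply, antipode]

theorem surfaceDist_swap_left {a b d a' b' d' : ℝ} (h h') :
    surfaceDist (oct a b d h) (oct a' b' d' h') =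
      surfaceDist (oct b a d (by linarith)) (oct b' a' d' (by linarith)) := by
  rw [← surfaceDist_isometryEquiv (signedPerm (Equiv.swap 0 1) 1)]
  congr 1
  all_goals
    apply Subtype.ext
    ext i
    fin_cases i
    · change (signedPerm _ _ _).1 0 = vec _ _ _ 0
      simp [signedPerm_apply, oct]
    · change (signedPerm _ _ _).1 1 = vec _ _ _ 1
      simp [signedPerm_apply, oct]
    · change (signedPerm _ _ _).1 2 = vec _ _ _ 2
      rw [signedPerm_apply, Equiv.swap_apply_of_ne_of_ne (by decide) (by decide)]
      simp [oct]

theorem surfaceDist_swap_right {a b d a' b' d' : ℝ} (h h') :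
    surfaceDist (oct a b d h) (oct a' b' d' h') =
      surfaceDist (oct a d b (by linarith)) (oct a' d' b' (by linarith)) := by
  rw [← surfaceDist_isometryEquiv (signedPerm (Equiv.swap 1 2) 1)]
  congr 1
  all_goals
    apply Subtype.ext
    ext i
    fin_cases i
    · change (signedPerm _ _ _).1 0 = vec _ _ _ 0
      rw [signedPerm_apply, Equiv.swap_apply_of_ne_of_ne (by decide) (by decide)]
      simp [oct]
    · change (signedPerm _ _ _).1 1 = vec _ _ _ 1
      simp [signedPerm_apply, oct]
    · change (signedPerm _ _ _).1 2 = vec _ _ _ 2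
      simp [signedPerm_apply, oct]

/-! ### The plane with coordinates adapted to the triangular lattice -/

/-- The point of the plane with lattice coordinates `ξ` (horizontal, in half edges) and `h`
(vertical, in heights of a face). -/
noncomputable def plane (ξ h : ℝ) : ℂ := ⟨√3 / 2 * ξ, 3 / 2 * h⟩

theorem dist_plane (ξ h ξ' h' : ℝ) :
    dist (plane ξ h) (plane ξ' h') = √(3 / 4 * (ξ - ξ') ^ 2 + 9 / 4 * (h - h') ^ 2) := by
  rw [Complex.dist_eq_re_im]
  congr 1
  simp only [plane]
  have : √3 ^ 2 = (3 : ℝ) := Real.sq_sqrt (by norm_num)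
  linear_combination (ξ - ξ') ^ 2 / 4 * this

theorem exists_plane (u : ℂ) : ∃ ξ h, u = plane ξ h := by
  have : √3 ≠ (0 : ℝ) := by positivity
  refine ⟨2 / √3 * u.re, 2 / 3 * u.im, Complex.ext ?_ ?_⟩
  · simp only [plane]; field_simp
  · simp only [plane]; ring

theorem plane_coords (ξ h : ℝ) :
    2 / √3 * (plane ξ h).re = ξ ∧ 2 / 3 * (plane ξ h).im = h := by
  have h3 : √3 ≠ (0 : ℝ) := by positivity
  constructor
  · simp only [plane]; field_simp
  · simp only [plane]; ring

/-! ### Developing four consecutive faces -/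

open Classical in
/-- The map which rolls the strip of four triangles up onto four consecutive faces. -/
noncomputable def rollUp (u : ℂ) : Octahedron :=
  let ξ := 2 / √3 * u.re
  let h := 2 / 3 * u.im
  let v := vec (max (1 - (ξ + h) / 2) (max (-h) ((ξ - 4 - h) / 2)))
    (max (min h ((2 + h - ξ) / 2)) (h - 1)) (min ((ξ - h) / 2) (min (1 - h) ((4 - h - ξ) / 2)))
  if hv : v ∈ octahedronSurface then ⟨v, hv⟩ else oct 1 0 0 (by simp)

theorem rollUp_plane {ξ h a b d : ℝ} (hv : |a| + |b| + |d| = 1)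
    (ha : max (1 - (ξ + h) / 2) (max (-h) ((ξ - 4 - h) / 2)) = a)
    (hb : max (min h ((2 + h - ξ) / 2)) (h - 1) = b)
    (hd : min ((ξ - h) / 2) (min (1 - h) ((4 - h - ξ) / 2)) = d) :
    rollUp (plane ξ h) = oct a b d hv := by
  obtain ⟨e1, e2⟩ := plane_coords ξ h
  unfold rollUp
  dsimp only
  split_ifs with h'
  · apply Subtype.ext
    simp only [oct, e1, e2, ha, hb, hd]
  · exact absurd (by rw [e1, e2, ha, hb, hd]; exact vec_mem_iff.2 hv) h'

/-- The strip carries the vertices +a, +b, +d, -a, -b, -d at ξ = 0, 1, 2, 3, 4, 5, with heights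
alternating between 0 and 1. On each triangle the nested maxima and minima select the affine branch
recorded here and in the next three lemmas. -/
theorem rollUp_first {ξ h : ℝ} (h1 : 0 ≤ h) (h2 : h ≤ ξ) (h3 : ξ + h ≤ 2) :
    rollUp (plane ξ h) = oct (1 - (ξ + h) / 2) h ((ξ - h) / 2) (by
      rw [abs_of_nonneg (by linarith), abs_of_nonneg h1, abs_of_nonneg (by linarith)]; ring) := by
  apply rollUp_plane
  · rw [max_eq_left (a := 1 - (ξ + h) / 2)]; apply max_le <;> linarith
  · rw [min_eq_left (by linarith), max_eq_left (by linarith)]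
  · rw [min_eq_left]; apply le_min <;> linarith

theorem rollUp_second {ξ h : ℝ} (h1 : h ≤ 1) (h2 : 2 ≤ ξ + h) (h3 : ξ - h ≤ 2) :
    rollUp (plane ξ h) = oct (1 - (ξ + h) / 2) ((2 + h - ξ) / 2) (1 - h) (by
      rw [abs_of_nonpos (by linarith), abs_of_nonneg (by linarith), abs_of_nonneg (by linarith)]
      ring) := by
  apply rollUp_plane
  · rw [max_eq_left (a := 1 - (ξ + h) / 2)]; apply max_le <;> linarith
  · rw [min_eq_right (by linarith), max_eq_left (by linarith)]
  · rw [min_eq_left (b := (4 - h - ξ) / 2) (by linarith), min_eq_right (by linarith)]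

theorem rollUp_third {ξ h : ℝ} (h1 : 0 ≤ h) (h2 : 2 ≤ ξ - h) (h3 : ξ + h ≤ 4) :
    rollUp (plane ξ h) = oct (-h) ((2 + h - ξ) / 2) ((4 - h - ξ) / 2) (by
      rw [abs_of_nonpos (by linarith), abs_of_nonpos (by linarith), abs_of_nonneg (by linarith)]
      ring) := by
  apply rollUp_plane
  · rw [max_eq_left (b := (ξ - 4 - h) / 2) (by linarith), max_eq_right (by linarith)]
  · rw [min_eq_right (by linarith), max_eq_left (by linarith)]
  · rw [min_eq_right (b := (4 - h - ξ) / 2) (by linarith), min_eq_right (by linarith)]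

theorem rollUp_fourth {ξ h : ℝ} (h1 : h ≤ 1) (h2 : 4 ≤ ξ + h) (h3 : ξ - h ≤ 4) :
    rollUp (plane ξ h) = oct ((ξ - 4 - h) / 2) (h - 1) ((4 - h - ξ) / 2) (by
      rw [abs_of_nonpos (by linarith), abs_of_nonpos (by linarith), abs_of_nonpos (by linarith)]
      ring) := by
  apply rollUp_plane
  · rw [max_eq_right (a := -h) (by linarith), max_eq_right (by linarith)]
  · rw [min_eq_right (by linarith), max_eq_right (by linarith)]
  · rw [min_eq_right (b := (4 - h - ξ) / 2) (by linarith), min_eq_right (by linarith)]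

theorem plane_continuous_coords :
    Continuous (fun u : ℂ => 2 / √3 * u.re) ∧ Continuous (fun u : ℂ => 2 / 3 * u.im) :=
  ⟨by fun_prop, by fun_prop⟩

/-- The four closed triangles of the strip. -/
def stripPiece : Fin 4 → Set ℂ :=
  ![{u | 0 ≤ 2 / 3 * u.im ∧ 2 / 3 * u.im ≤ 2 / √3 * u.re ∧ 2 / √3 * u.re + 2 / 3 * u.im ≤ 2},
    {u | 2 / 3 * u.im ≤ 1 ∧ 2 ≤ 2 / √3 * u.re + 2 / 3 * u.im ∧ 2 / √3 * u.re - 2 / 3 * u.im ≤ 2},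
    {u | 0 ≤ 2 / 3 * u.im ∧ 2 ≤ 2 / √3 * u.re - 2 / 3 * u.im ∧ 2 / √3 * u.re + 2 / 3 * u.im ≤ 4},
    {u | 2 / 3 * u.im ≤ 1 ∧ 4 ≤ 2 / √3 * u.re + 2 / 3 * u.im ∧ 2 / √3 * u.re - 2 / 3 * u.im ≤ 4}]

theorem isClosed_stripPiece (i : Fin 4) : IsClosed (stripPiece i) := by
  obtain ⟨c1, c2⟩ := plane_continuous_coords
  fin_cases i
  · exact (isClosed_le continuous_const c2).inter ((isClosed_le c2 c1).inter
      (isClosed_le (c1.add c2) continuous_const))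
  · exact (isClosed_le c2 continuous_const).inter ((isClosed_le continuous_const (c1.add c2)).inter
      (isClosed_le (c1.sub c2) continuous_const))
  · exact (isClosed_le continuous_const c2).inter ((isClosed_le continuous_const (c1.sub c2)).inter
      (isClosed_le (c1.add c2) continuous_const))
  · exact (isClosed_le c2 continuous_const).inter ((isClosed_le continuous_const (c1.add c2)).inter
      (isClosed_le (c1.sub c2) continuous_const))

theorem edist_rollUp_le (i : Fin 4) {u v : ℂ} (hu : u ∈ stripPiece i) (hv : v ∈ stripPiece i) :
    edist (rollUp u) (rollUp v) ≤ edist u v := by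
  obtain ⟨ξ, h, rfl⟩ := exists_plane u
  obtain ⟨ξ', h', rfl⟩ := exists_plane v
  rw [edist_dist, edist_dist]
  refine ENNReal.ofReal_le_ofReal (le_of_eq ?_)
  have e := plane_coords ξ h
  have e' := plane_coords ξ' h'
  fin_cases i <;>
    simp only [stripPiece, Fin.zero_eta, Fin.mk_one, Fin.reduceFinMk, Matrix.cons_val,
      Matrix.cons_val_zero, Matrix.cons_val_one, Set.mem_ofPred_eq, e.1, e.2, e'.1, e'.2] at hu hv
  · rw [rollUp_first hu.1 hu.2.1 hu.2.2, rollUp_first hv.1 hv.2.1 hv.2.2, Subtype.dist_eq]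
    simp only [oct]
    rw [dist_vec, dist_plane]
    congr 1; ring
  · rw [rollUp_second hu.1 hu.2.1 hu.2.2, rollUp_second hv.1 hv.2.1 hv.2.2, Subtype.dist_eq]
    simp only [oct]
    rw [dist_vec, dist_plane]
    congr 1; ring
  · rw [rollUp_third hu.1 hu.2.1 hu.2.2, rollUp_third hv.1 hv.2.1 hv.2.2, Subtype.dist_eq]
    simp only [oct]
    rw [dist_vec, dist_plane]
    congr 1; ring
  · rw [rollUp_fourth hu.1 hu.2.1 hu.2.2, rollUp_fourth hv.1 hv.2.1 hv.2.2, Subtype.dist_eq]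
    simp only [oct]
    rw [dist_vec, dist_plane]
    congr 1; ring

theorem surfaceDist_rollUp_le {ξ h ξ' h' : ℝ} (h0 : 0 ≤ h) (h1 : h ≤ 1) (h2 : h ≤ ξ)
    (h3 : ξ ≤ 4 + h) (h0' : 0 ≤ h') (h1' : h' ≤ 1) (h2' : h' ≤ ξ') (h3' : ξ' ≤ 4 + h') :
    surfaceDist (rollUp (plane ξ h)) (rollUp (plane ξ' h')) ≤
      ENNReal.ofReal √(3 / 4 * (ξ - ξ') ^ 2 + 9 / 4 * (h - h') ^ 2) := by
  rw [← dist_plane, ← edist_dist]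
  -- The four triangles form a parallelogram. Its convexity makes every segment between two of its
  -- points roll up to a path, so no visibility condition is needed.
  let K : Set ℂ := {u | 0 ≤ 2 / 3 * u.im ∧ 2 / 3 * u.im ≤ 1 ∧ 2 / 3 * u.im ≤ 2 / √3 * u.re ∧
    2 / √3 * u.re ≤ 4 + 2 / 3 * u.im}
  have hK : Convex ℝ K := by
    rintro u ⟨a0, a1, a2, a3⟩ v ⟨b0, b1, b2, b3⟩ s t hs ht hst
    simp only [K, Set.mem_ofPred_eq, Complex.add_re, Complex.add_im, Complex.real_smul,
      Complex.re_ofReal_mul, Complex.im_ofReal_mul]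
    refine ⟨by nlinarith, by nlinarith, by nlinarith, by nlinarith⟩
  refine surfaceDist_le_of_pieces hK (C := stripPiece) Finset.univ
    (fun i _ => isClosed_stripPiece i) ?_ (fun i _ u hu v hv => edist_rollUp_le i hu hv) ?_ ?_
  · rintro u ⟨a0, a1, a2, a3⟩
    by_cases c1 : 2 / √3 * u.re + 2 / 3 * u.im ≤ 2
    · exact ⟨0, by simp, a0, a2, c1⟩
    by_cases c2 : 2 / √3 * u.re - 2 / 3 * u.im ≤ 2
    · exact ⟨1, by simp, a1, (not_le.1 c1).le, c2⟩
    by_cases c3 : 2 / √3 * u.re + 2 / 3 * u.im ≤ 4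
    · exact ⟨2, by simp, a0, (not_le.1 c2).le, c3⟩
    · exact ⟨3, by simp, a1, (not_le.1 c3).le, by linarith⟩
  · simp only [K, Set.mem_ofPred_eq, (plane_coords ξ h).1, (plane_coords ξ h).2]
    exact ⟨h0, h1, h2, h3⟩
  · simp only [K, Set.mem_ofPred_eq, (plane_coords ξ' h').1, (plane_coords ξ' h').2]
    exact ⟨h0', h1', h2', h3'⟩

theorem surfaceDist_le_second {a b d a' b' d' : ℝ} (ha : 0 ≤ a) (hb : 0 ≤ b) (hd : 0 ≤ d)
    (ha' : 0 ≤ a') (hb' : 0 ≤ b') (hd' : 0 ≤ d') (h h') :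
    surfaceDist (oct a b d h) (oct (-a') b' d' h') ≤
      ENNReal.ofReal √(3 / 4 * (b + 2 * d - (b' + 2 * d' + 3 * a')) ^ 2 +
        9 / 4 * (b - (a' + b')) ^ 2) := by
  have s : a + b + d = 1 := by rwa [abs_of_nonneg ha, abs_of_nonneg hb, abs_of_nonneg hd] at h
  have s' : a' + b' + d' = 1 := by
    rwa [abs_neg, abs_of_nonneg ha', abs_of_nonneg hb', abs_of_nonneg hd'] at h'
  have e := (rollUp_first (ξ := b + 2 * d) (h := b) hb (by linarith) (by linarith)).trans
    (oct_inj.2 ⟨by linarith, by linarith, by linarith⟩ : _ = oct a b d h)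
  have e' := (rollUp_second (ξ := b' + 2 * d' + 3 * a') (h := a' + b') (by linarith) (by linarith)
    (by linarith)).trans
    (oct_inj.2 ⟨by linarith, by linarith, by linarith⟩ : _ = oct (-a') b' d' h')
  rw [← e, ← e']
  apply surfaceDist_rollUp_le <;> linarith

theorem surfaceDist_le_third {a b d a' b' d' : ℝ} (ha : 0 ≤ a) (hb : 0 ≤ b) (hd : 0 ≤ d)
    (ha' : 0 ≤ a') (hb' : 0 ≤ b') (hd' : 0 ≤ d') (h h') :
    surfaceDist (oct a b d h) (oct (-a') (-b') d' h') ≤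
      ENNReal.ofReal √(3 / 4 * (b + 2 * d - (2 * d' + 3 * a' + 4 * b')) ^ 2 +
        9 / 4 * (b - a') ^ 2) := by
  have s : a + b + d = 1 := by rwa [abs_of_nonneg ha, abs_of_nonneg hb, abs_of_nonneg hd] at h
  have s' : a' + b' + d' = 1 := by
    rwa [abs_neg, abs_neg, abs_of_nonneg ha', abs_of_nonneg hb', abs_of_nonneg hd'] at h'
  have e := (rollUp_first (ξ := b + 2 * d) (h := b) hb (by linarith) (by linarith)).trans
    (oct_inj.2 ⟨by linarith, by linarith, by linarith⟩ : _ = oct a b d h)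
  have e' := (rollUp_third (ξ := 2 * d' + 3 * a' + 4 * b') (h := a') (by linarith) (by linarith)
    (by linarith)).trans
    (oct_inj.2 ⟨by linarith, by linarith, by linarith⟩ : _ = oct (-a') (-b') d' h')
  rw [← e, ← e']
  apply surfaceDist_rollUp_le <;> linarith

/-- The squared length is rewritten along another lattice direction. In this form exchanging `a` and
`d` only changes the sign of `(d' - a') - (d - a)`, so that the mirror strip gives the same
expression with the opposite sign. -/
theorem surfaceDist_le_fourth {a b d a' b' d' : ℝ} (ha : 0 ≤ a) (hb : 0 ≤ b) (hd : 0 ≤ d)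
    (ha' : 0 ≤ a') (hb' : 0 ≤ b') (hd' : 0 ≤ d') (h h') :
    surfaceDist (oct a b d h) (oct (-a') (-b') (-d') h') ≤
      ENNReal.ofReal √(9 / 4 * (1 - b - b') ^ 2 + 3 / 4 * (3 + ((d' - a') - (d - a))) ^ 2) := by
  have s : a + b + d = 1 := by rwa [abs_of_nonneg ha, abs_of_nonneg hb, abs_of_nonneg hd] at h
  have s' : a' + b' + d' = 1 := by
    rwa [abs_neg, abs_neg, abs_neg, abs_of_nonneg ha', abs_of_nonneg hb', abs_of_nonneg hd'] at h'
  have e := (rollUp_first (ξ := b + 2 * d) (h := b) hb (by linarith) (by linarith)).trans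
    (oct_inj.2 ⟨by linarith, by linarith, by linarith⟩ : _ = oct a b d h)
  have e' := (rollUp_fourth (ξ := 3 * a' + 4 * b' + 5 * d') (h := a' + d') (by linarith)
    (by linarith) (by linarith)).trans
    (oct_inj.2 ⟨by linarith, by linarith, by linarith⟩ : _ = oct (-a') (-b') (-d') h')
  rw [← e, ← e']
  refine (surfaceDist_rollUp_le (by linarith) (by linarith) (by linarith) (by linarith)
    (by linarith) (by linarith) (by linarith) (by linarith)).trans
    (ENNReal.ofReal_le_ofReal (Real.sqrt_le_sqrt (le_of_eq ?_)))
  obtain rfl : a = 1 - b - d := by linarith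
  obtain rfl : a' = 1 - b' - d' := by linarith
  ring

/-! ### The band of six faces between two opposite faces -/

/-- The angular coordinate of the band, well defined modulo `6`. -/
noncomputable def angle (a b d : ℝ) : ℝ :=
  max (-b) 0 + 2 * max d 0 + 3 * max (-a) 0 + 4 * max b 0 + 5 * max (-d) 0 +
    if d < 0 ∨ 0 < b then 6 * (max a 0 + max (-b) 0) else 0

/-- The closed faces of the band. -/
def bandFace : Fin 6 → Set (EuclideanSpace ℝ (Fin 3)) :=
  ![{v | v ∈ octahedronSurface ∧ 0 ≤ v 0 ∧ v 1 ≤ 0 ∧ 0 ≤ v 2},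
    {v | v ∈ octahedronSurface ∧ v 0 ≤ 0 ∧ v 1 ≤ 0 ∧ 0 ≤ v 2},
    {v | v ∈ octahedronSurface ∧ v 0 ≤ 0 ∧ 0 ≤ v 1 ∧ 0 ≤ v 2},
    {v | v ∈ octahedronSurface ∧ v 0 ≤ 0 ∧ 0 ≤ v 1 ∧ v 2 ≤ 0},
    {v | v ∈ octahedronSurface ∧ 0 ≤ v 0 ∧ 0 ≤ v 1 ∧ v 2 ≤ 0},
    {v | v ∈ octahedronSurface ∧ 0 ≤ v 0 ∧ v 1 ≤ 0 ∧ v 2 ≤ 0}]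

theorem isClosed_octahedronSurface : IsClosed octahedronSurface := by
  refine isClosed_eq ?_ continuous_const
  fun_prop

theorem isClosed_coord_nonneg (i : Fin 3) : IsClosed {v : EuclideanSpace ℝ (Fin 3) | 0 ≤ v i} :=
  isClosed_le continuous_const (by fun_prop)

theorem isClosed_coord_nonpos (i : Fin 3) : IsClosed {v : EuclideanSpace ℝ (Fin 3) | v i ≤ 0} :=
  isClosed_le (by fun_prop) continuous_const

theorem isClosed_bandFace (i : Fin 6) : IsClosed (bandFace i) := by
  have s := isClosed_octahedronSurface
  have p := isClosed_coord_nonneg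
  have n := isClosed_coord_nonpos
  fin_cases i
  · exact s.inter ((p 0).inter ((n 1).inter (p 2)))
  · exact s.inter ((n 0).inter ((n 1).inter (p 2)))
  · exact s.inter ((n 0).inter ((p 1).inter (p 2)))
  · exact s.inter ((n 0).inter ((p 1).inter (n 2)))
  · exact s.inter ((p 0).inter ((p 1).inter (n 2)))
  · exact s.inter ((p 0).inter ((n 1).inter (n 2)))

theorem vec_sign_iff (a b d : ℝ) :
    (0 ≤ vec a b d 0 ↔ 0 ≤ a) ∧ (vec a b d 0 ≤ 0 ↔ a ≤ 0) ∧
    (0 ≤ vec a b d 1 ↔ 0 ≤ b) ∧ (vec a b d 1 ≤ 0 ↔ b ≤ 0) ∧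
    (0 ≤ vec a b d 2 ↔ 0 ≤ d) ∧ (vec a b d 2 ≤ 0 ↔ d ≤ 0) := by
  have hc := sqrt_three_halves_pos
  simp only [vec_zero, vec_one, vec_two]
  refine ⟨mul_nonneg_iff_of_pos_left hc, ?_, mul_nonneg_iff_of_pos_left hc, ?_,
    mul_nonneg_iff_of_pos_left hc, ?_⟩ <;>
  exact ⟨fun h => by by_contra h'; exact absurd h (not_le.2 (mul_pos hc (not_le.1 h'))),
    fun h => mul_nonpos_of_nonneg_of_nonpos hc.le h⟩

/-- `u` is a position of the point `v` of the band in the universal cover of the band. -/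
def IsLift (v : EuclideanSpace ℝ (Fin 3)) (u : ℂ) : Prop :=
  ∃ a b d : ℝ, ∃ n : ℤ, v = vec a b d ∧ u = plane (angle a b d + 6 * n) ((1 - (a + b + d)) / 2)

/-- `he` says that the linear form `L` together with the height is an isometric chart of the face.
The angle agrees with `L` only modulo 6, and the integers `k`, `k'` are absorbed by the deck
translation. -/
theorem IsLift.step {a b d a' b' d' : ℝ} {L : ℝ → ℝ → ℝ → ℝ} {u : ℂ}
    (hu : IsLift (vec a b d) u)
    (hL : ∃ k : ℤ, angle a b d = L a b d + 6 * k)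
    (hL' : ∃ k : ℤ, angle a' b' d' = L a' b' d' + 6 * k)
    (he : 3 / 4 * (L a b d - L a' b' d') ^ 2 +
        9 / 4 * ((1 - (a + b + d)) / 2 - (1 - (a' + b' + d')) / 2) ^ 2 =
      3 / 2 * ((a - a') ^ 2 + (b - b') ^ 2 + (d - d') ^ 2)) :
    ∃ w, IsLift (vec a' b' d') w ∧ edist u w ≤ edist (vec a b d) (vec a' b' d') := by
  obtain ⟨a₁, b₁, d₁, n, hv, rfl⟩ := hu
  obtain ⟨rfl, rfl, rfl⟩ := vec_inj.1 hv
  obtain ⟨k, hk⟩ := hL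
  obtain ⟨k', hk'⟩ := hL'
  refine ⟨_, ⟨a', b', d', n + k - k', rfl, rfl⟩, ?_⟩
  rw [edist_dist, edist_dist, dist_plane, dist_vec, ← he, hk, hk']
  refine ENNReal.ofReal_le_ofReal (Real.sqrt_le_sqrt (le_of_eq ?_))
  push_cast
  ring

/-- The vertices +a, -b, +d, -a, +b, -d have the positions 0, …, 5, and a point of a face gets the
average weighted by its coordinates. The last two faces lie past the seam: they see +a at 6, and the
last one sees -b at 7. -/
theorem IsLift.step_bandFace (i : Fin 6) {x y : EuclideanSpace ℝ (Fin 3)} (hx : x ∈ bandFace i)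
    (hy : y ∈ bandFace i) {u : ℂ} (hu : IsLift x u) :
    ∃ w, IsLift y w ∧ edist u w ≤ edist x y := by
  obtain ⟨a, b, d, rfl⟩ := exists_vec x
  obtain ⟨a', b', d', rfl⟩ := exists_vec y
  fin_cases i <;>
    simp only [bandFace, Fin.zero_eta, Fin.mk_one, Fin.reduceFinMk, Matrix.cons_val,
      Matrix.cons_val_zero, Matrix.cons_val_one, Set.mem_ofPred_eq, vec_sign_iff,
      vec_mem_iff] at hx hy <;>
    obtain ⟨s, h0, h1, h2⟩ := hx <;> obtain ⟨s', h0', h1', h2'⟩ := hy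
  · have hL : ∀ {a b d : ℝ}, |a| + |b| + |d| = 1 → 0 ≤ a → b ≤ 0 → 0 ≤ d →
        (∃ k : ℤ, angle a b d = (fun _ b d => -b + 2 * d) a b d + 6 * k) ∧ a - b + d = 1 := by
      intro a b d s h0 h1 h2
      rw [abs_of_nonneg h0, abs_of_nonpos h1, abs_of_nonneg h2] at s
      refine ⟨⟨0, ?_⟩, by linarith⟩
      rw [angle, max_eq_left (by linarith : 0 ≤ -b), max_eq_left h2,
        max_eq_right (by linarith : -a ≤ 0), max_eq_right h1, max_eq_right (by linarith : -d ≤ 0),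
        if_neg (by rintro (h | h) <;> linarith)]
      push_cast; ring
    obtain ⟨k, e⟩ := hL s h0 h1 h2
    obtain ⟨k', e'⟩ := hL s' h0' h1' h2'
    refine hu.step (L := fun _ b d => -b + 2 * d) k k' ?_
    obtain rfl : a = 1 + b - d := by linarith
    obtain rfl : a' = 1 + b' - d' := by linarith
    ring
  · have hL : ∀ {a b d : ℝ}, |a| + |b| + |d| = 1 → a ≤ 0 → b ≤ 0 → 0 ≤ d →
        (∃ k : ℤ, angle a b d = (fun a b d => -b + 2 * d - 3 * a) a b d + 6 * k) ∧
          - a - b + d = 1 := by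
      intro a b d s h0 h1 h2
      rw [abs_of_nonpos h0, abs_of_nonpos h1, abs_of_nonneg h2] at s
      refine ⟨⟨0, ?_⟩, by linarith⟩
      rw [angle, max_eq_left (by linarith : 0 ≤ -b), max_eq_left h2,
        max_eq_left (by linarith : 0 ≤ -a), max_eq_right h1, max_eq_right (by linarith : -d ≤ 0),
        if_neg (by rintro (h | h) <;> linarith)]
      push_cast; ring
    obtain ⟨k, e⟩ := hL s h0 h1 h2
    obtain ⟨k', e'⟩ := hL s' h0' h1' h2'
    refine hu.step (L := fun a b d => -b + 2 * d - 3 * a) k k' ?_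
    obtain rfl : d = 1 + b + a := by linarith
    obtain rfl : d' = 1 + b' + a' := by linarith
    ring
  · have hL : ∀ {a b d : ℝ}, |a| + |b| + |d| = 1 → a ≤ 0 → 0 ≤ b → 0 ≤ d →
        (∃ k : ℤ, angle a b d = (fun a b d => 2 * d - 3 * a + 4 * b) a b d + 6 * k) ∧
          - a + b + d = 1 := by
      intro a b d s h0 h1 h2
      rw [abs_of_nonpos h0, abs_of_nonneg h1, abs_of_nonneg h2] at s
      refine ⟨⟨0, ?_⟩, by linarith⟩
      rw [angle, max_eq_right (by linarith : -b ≤ 0), max_eq_left h2,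
        max_eq_left (by linarith : 0 ≤ -a), max_eq_left h1, max_eq_right (by linarith : -d ≤ 0),
        max_eq_right h0]
      push_cast; split_ifs <;> ring
    obtain ⟨k, e⟩ := hL s h0 h1 h2
    obtain ⟨k', e'⟩ := hL s' h0' h1' h2'
    refine hu.step (L := fun a b d => 2 * d - 3 * a + 4 * b) k k' ?_
    obtain rfl : d = 1 - b + a := by linarith
    obtain rfl : d' = 1 - b' + a' := by linarith
    ring
  · have hL : ∀ {a b d : ℝ}, |a| + |b| + |d| = 1 → a ≤ 0 → 0 ≤ b → d ≤ 0 →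
        (∃ k : ℤ, angle a b d = (fun a b d => -3 * a + 4 * b - 5 * d) a b d + 6 * k) ∧
          - a + b - d = 1 := by
      intro a b d s h0 h1 h2
      rw [abs_of_nonpos h0, abs_of_nonneg h1, abs_of_nonpos h2] at s
      refine ⟨⟨0, ?_⟩, by linarith⟩
      rw [angle, max_eq_right (by linarith : -b ≤ 0), max_eq_right h2,
        max_eq_left (by linarith : 0 ≤ -a), max_eq_left h1, max_eq_left (by linarith : 0 ≤ -d),
        max_eq_right h0]
      push_cast; split_ifs <;> ring
    obtain ⟨k, e⟩ := hL s h0 h1 h2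
    obtain ⟨k', e'⟩ := hL s' h0' h1' h2'
    refine hu.step (L := fun a b d => -3 * a + 4 * b - 5 * d) k k' ?_
    obtain rfl : b = 1 + d + a := by linarith
    obtain rfl : b' = 1 + d' + a' := by linarith
    ring
  · have hL : ∀ {a b d : ℝ}, |a| + |b| + |d| = 1 → 0 ≤ a → 0 ≤ b → d ≤ 0 →
        (∃ k : ℤ, angle a b d = (fun a b d => 4 * b - 5 * d + 6 * a) a b d + 6 * k) ∧
          a + b - d = 1 := by
      intro a b d s h0 h1 h2
      rw [abs_of_nonneg h0, abs_of_nonneg h1, abs_of_nonpos h2] at s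
      refine ⟨?_, by linarith⟩
      rw [angle, max_eq_right (by linarith : -b ≤ 0), max_eq_right h2,
        max_eq_right (by linarith : -a ≤ 0), max_eq_left h1, max_eq_left (by linarith : 0 ≤ -d),
        max_eq_left h0]
      split_ifs with hc
      · exact ⟨0, by push_cast; ring⟩
      · rw [not_or, not_lt, not_lt] at hc
        -- Only the vertex +a is left, whose angle is 0 while this face places it at 6.
        exact ⟨-1, by push_cast; linarith⟩
    obtain ⟨k, e⟩ := hL s h0 h1 h2
    obtain ⟨k', e'⟩ := hL s' h0' h1' h2'
    refine hu.step (L := fun a b d => 4 * b - 5 * d + 6 * a) k k' ?_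
    obtain rfl : a = 1 + d - b := by linarith
    obtain rfl : a' = 1 + d' - b' := by linarith
    ring
  · have hL : ∀ {a b d : ℝ}, |a| + |b| + |d| = 1 → 0 ≤ a → b ≤ 0 → d ≤ 0 →
        (∃ k : ℤ, angle a b d = (fun a b d => -5 * d + 6 * a - 7 * b) a b d + 6 * k) ∧
          a - b - d = 1 := by
      intro a b d s h0 h1 h2
      rw [abs_of_nonneg h0, abs_of_nonpos h1, abs_of_nonpos h2] at s
      refine ⟨?_, by linarith⟩
      rw [angle, max_eq_left (by linarith : 0 ≤ -b), max_eq_right h2,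
        max_eq_right (by linarith : -a ≤ 0), max_eq_right h1, max_eq_left (by linarith : 0 ≤ -d),
        max_eq_left h0]
      split_ifs with hc
      · exact ⟨0, by push_cast; ring⟩
      · rw [not_or, not_lt, not_lt] at hc
        exact ⟨-1, by push_cast; linarith⟩
    obtain ⟨k, e⟩ := hL s h0 h1 h2
    obtain ⟨k', e'⟩ := hL s' h0' h1' h2'
    refine hu.step (L := fun a b d => -5 * d + 6 * a - 7 * b) k k' ?_
    obtain rfl : a = 1 + d + b := by linarith
    obtain rfl : a' = 1 + d' + b' := by linarith
    ring

/-! ### The lower bound for the distance of points on opposite faces -/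

theorem sq_le_add_six_mul_sq {u : ℝ} (hu : |u| ≤ 3) (n : ℤ) : u ^ 2 ≤ (u + 6 * n) ^ 2 := by
  obtain ⟨h1, h2⟩ := abs_le.1 hu
  rcases lt_trichotomy n 0 with h | rfl | h
  · have : (n : ℝ) ≤ -1 := by exact_mod_cast Int.le_sub_one_of_lt h
    nlinarith
  · simp
  · have : (1 : ℝ) ≤ n := by exact_mod_cast h
    nlinarith

theorem sub_abs_sq_le (u : ℝ) : (3 - |u|) ^ 2 ≤ (3 + u) ^ 2 := by
  rcases abs_cases u with ⟨h, _⟩ | ⟨h, _⟩ <;> rw [h] <;> nlinarith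

/-- The squared distance in a development for which the first and the last flip are different. -/
theorem glide_le {a b d a' b' d' : ℝ} (ha : 0 ≤ a) (hb : 0 ≤ b) (hd : 0 ≤ d)
    (ha' : 0 ≤ a') (hb' : 0 ≤ b') (hd' : 0 ≤ d') (s : a + b + d = 1) (s' : a' + b' + d' = 1)
    {u : ℝ} (n : ℤ) (hu : u = 1 + d' - a' + d - b ∨ u = -(1 + d' - a' + d - b)) :
    9 / 4 * (1 - d - d') ^ 2 + 3 / 4 * (3 - |(b' - a') - (b - a)|) ^ 2 ≤
      3 / 4 * (u + 6 * n) ^ 2 + 9 / 4 * (1 + a + b') ^ 2 := by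
  have h1 : u ^ 2 = (1 + d' - a' + d - b) ^ 2 := by rcases hu with h | h <;> rw [h] <;> ring
  have h2 : |u| ≤ 3 := by
    rcases hu with h | h <;> rw [h, abs_le] <;> exact ⟨by linarith, by linarith⟩
  have h3 := sq_le_add_six_mul_sq h2 n
  have h4 := sub_abs_sq_le ((b' - a') - (b - a))
  -- One and the same strip of four faces in two lattice directions: on the left as in the upper
  -- bound, on the right as unfolded through the band.
  have h5 : 9 / 4 * (1 - d - d') ^ 2 + 3 / 4 * (3 + ((b' - a') - (b - a))) ^ 2 =
      3 / 4 * (1 + d' - a' + d - b) ^ 2 + 9 / 4 * (1 + a + b') ^ 2 := by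
    obtain rfl : d = 1 - a - b := by linarith
    obtain rfl : d' = 1 - a' - b' := by linarith
    ring
  linarith

/-- The squared distance in a development for which the first and the last flip are equal. -/
theorem translate_le {a t a' : ℝ} (ha : 0 ≤ a) (ha' : 0 ≤ a')
    {u : ℝ} (n : ℤ) (hu : u = 3 + t) (ht : |t| ≤ 2) :
    9 / 4 * (1 - a - a') ^ 2 + 3 / 4 * (3 - |t|) ^ 2 ≤
      3 / 4 * (u + 6 * n) ^ 2 + 9 / 4 * (1 + a + a') ^ 2 := by
  -- The representative of 3 + t modulo 6 of least absolute value is t - 3 for t ≥ 0 and t + 3 for t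
  -- < 0.
  have h0 : (3 - |t|) ^ 2 ≤ (u + 6 * n) ^ 2 := by
    subst hu
    rcases abs_cases t with ⟨h, h'⟩ | ⟨h, h'⟩ <;> rw [h] at ht ⊢
    · have := sq_le_add_six_mul_sq (u := -3 + t) (by rw [abs_le]; constructor <;> linarith) (n + 1)
      push_cast at this
      calc _ = (-3 + t) ^ 2 := by ring
        _ ≤ _ := this
        _ = _ := by ring
    · have := sq_le_add_six_mul_sq (u := 3 + t) (by rw [abs_le]; constructor <;> linarith) n
      calc _ = (3 + t) ^ 2 := by ring
        _ ≤ _ := this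
  nlinarith

/-- The points `e` and `f` are where the path leaves the first face and enters the last one. The two
end pieces are copied isometrically into the plane, the band piece is lifted, and the plane triangle
inequality does the rest. -/
theorem development_triangle {p e f q : EuclideanSpace ℝ (Fin 3)} {ξ h ξ₁ h₁ ξ₂ h₂ ξ' h' : ℝ}
    {V : ℝ≥0∞} {m : ℝ}
    (h1 : dist p e = dist (plane ξ h) (plane ξ₁ h₁))
    (h2 : edist (plane ξ₁ h₁) (plane ξ₂ h₂) ≤ V)
    (h3 : dist f q = dist (plane ξ₂ h₂) (plane ξ' h'))
    (hm : m ≤ 3 / 4 * (ξ - ξ') ^ 2 + 9 / 4 * (h - h') ^ 2) :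
    ENNReal.ofReal √m ≤ edist p e + V + edist f q := by
  calc ENNReal.ofReal √m ≤ edist (plane ξ h) (plane ξ' h') := by
        rw [edist_dist, dist_plane]
        exact ENNReal.ofReal_le_ofReal (Real.sqrt_le_sqrt hm)
    _ ≤ edist (plane ξ h) (plane ξ₁ h₁) + edist (plane ξ₁ h₁) (plane ξ₂ h₂) +
        edist (plane ξ₂ h₂) (plane ξ' h') := edist_triangle4 _ _ _ _
    _ ≤ _ := by
        rw [edist_dist p e, edist_dist f q, h1, h3, ← edist_dist, ← edist_dist]
        gcongr

theorem exists_isLift_of_top {x y z : ℝ} (hx : 0 ≤ x) (hy : 0 ≤ y) (hz : 0 ≤ z)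
    (t : x + y + z = 1) (t0 : x = 0 ∨ y = 0 ∨ z = 0) :
    ∃ ξ₁ : ℝ, IsLift (vec x y z) (plane ξ₁ 0) ∧
      ((ξ₁ = 2 * z + 4 * y ∧ x = 0) ∨ (ξ₁ = 2 * z ∧ y = 0) ∨ (ξ₁ = 4 * y + 6 * x ∧ z = 0)) := by
  rcases t0 with rfl | rfl | rfl
  · refine ⟨_, ⟨_, _, _, 0, rfl, ?_⟩, Or.inl ⟨rfl, rfl⟩⟩
    simp only [angle, neg_zero, max_self, max_eq_left hy, max_eq_left hz,
      max_eq_right (neg_nonpos.2 hy), max_eq_right (neg_nonpos.2 hz)]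
    rw [t]; simp [add_comm]
  · refine ⟨_, ⟨_, _, _, 0, rfl, ?_⟩, Or.inr (Or.inl ⟨rfl, rfl⟩)⟩
    simp only [angle, neg_zero, max_self, max_eq_left hx, max_eq_left hz,
      max_eq_right (neg_nonpos.2 hx), max_eq_right (neg_nonpos.2 hz)]
    rw [if_neg (by rintro (h | h) <;> linarith), t]; simp
  · rcases hy.eq_or_lt with rfl | hy0
    · obtain rfl : x = 1 := by linarith
      -- The vertex +a has angle 0, but as an end of the edge z = 0 it must appear at 6, hence the
      -- lift by one period.
      refine ⟨_, ⟨_, _, _, 1, rfl, ?_⟩, Or.inr (Or.inr ⟨rfl, rfl⟩)⟩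
      simp [angle]
    · refine ⟨_, ⟨_, _, _, 0, rfl, ?_⟩, Or.inr (Or.inr ⟨rfl, rfl⟩)⟩
      simp only [angle, neg_zero, max_self, max_eq_left hy, max_eq_left hx,
        max_eq_right (neg_nonpos.2 hy), max_eq_right (neg_nonpos.2 hx)]
      rw [t]; simp [hy0]

theorem exists_angle_of_bottom {x' y' z' : ℝ} (hx' : 0 ≤ x') (hy' : 0 ≤ y') (hz' : 0 ≤ z')
    (t' : x' + y' + z' = 1) (t0' : x' = 0 ∨ y' = 0 ∨ z' = 0) :
    ∃ k : ℤ, (angle (-x') (-y') (-z') = y' + 3 * x' + 6 * k ∧ z' = 0) ∨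
      (angle (-x') (-y') (-z') = 3 * x' + 5 * z' + 6 * k ∧ y' = 0) ∨
      (angle (-x') (-y') (-z') = 5 * z' + 7 * y' + 6 * k ∧ x' = 0) := by
  rcases t0' with rfl | rfl | rfl
  · rcases hz'.eq_or_lt with rfl | hz0
    · obtain rfl : y' = 1 := by linarith
      -- The vertex -b has angle 1, while the edge x' = 0 places it at 7.
      refine ⟨-1, Or.inr (Or.inr ⟨?_, rfl⟩)⟩
      simp [angle]; norm_num
    · refine ⟨0, Or.inr (Or.inr ⟨?_, rfl⟩)⟩
      simp only [angle, neg_zero, neg_neg, max_self, max_eq_left hy', max_eq_left hz',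
        max_eq_right (neg_nonpos.2 hy'), max_eq_right (neg_nonpos.2 hz')]
      rw [if_pos (Or.inl (by linarith))]; push_cast; ring
  · refine ⟨0, Or.inr (Or.inl ⟨?_, rfl⟩)⟩
    simp only [angle, neg_zero, neg_neg, max_self, max_eq_left hx', max_eq_left hz',
      max_eq_right (neg_nonpos.2 hx'), max_eq_right (neg_nonpos.2 hz')]
    simp
  · refine ⟨0, Or.inl ⟨?_, rfl⟩⟩
    simp only [angle, neg_zero, neg_neg, max_self, max_eq_left hx', max_eq_left hy',
      max_eq_right (neg_nonpos.2 hx'), max_eq_right (neg_nonpos.2 hy')]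
    rw [if_neg (by rintro (h | h) <;> linarith)]; push_cast; ring

/-- The top face is unfolded across its edge x = 0 to the outside of the strip 0 ≤ h ≤ 1, which
explains the height -a. The next lemmas do the same for the other edges, the bottom face landing
above height 1. -/
theorem dist_top_left {a b d x y z : ℝ} (s : a + b + d = 1) (t : x + y + z = 1) :
    x = 0 → dist (vec a b d) (vec x y z) =
      dist (plane (2 * d + 4 * b + 3 * a) (-a)) (plane (2 * z + 4 * y) 0) := by
  rintro rfl
  rw [dist_vec, dist_plane]
  congr 1
  obtain rfl : d = 1 - a - b := by linarith
  obtain rfl : z = 1 - y := by linarith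
  ring

theorem dist_top_mid {a b d x y z : ℝ} (s : a + b + d = 1) (t : x + y + z = 1) :
    y = 0 → dist (vec a b d) (vec x y z) =
      dist (plane (2 * d + b) (-b)) (plane (2 * z) 0) := by
  rintro rfl
  rw [dist_vec, dist_plane]
  congr 1
  obtain rfl : d = 1 - a - b := by linarith
  obtain rfl : z = 1 - x := by linarith
  ring

theorem dist_top_right {a b d x y z : ℝ} (s : a + b + d = 1) (t : x + y + z = 1) :
    z = 0 → dist (vec a b d) (vec x y z) =
      dist (plane (4 * b + 6 * a + 5 * d) (-d)) (plane (4 * y + 6 * x) 0) := by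
  rintro rfl
  rw [dist_vec, dist_plane]
  congr 1
  obtain rfl : d = 1 - a - b := by linarith
  obtain rfl : y = 1 - x := by linarith
  ring

theorem dist_bottom_left {a' b' d' x' y' z' : ℝ} (k n : ℤ) (s' : a' + b' + d' = 1)
    (t' : x' + y' + z' = 1) :
    x' = 0 → dist (vec (-x') (-y') (-z')) (vec (-a') (-b') (-d')) =
      dist (plane (5 * z' + 7 * y' + 6 * k + 6 * n) 1)
        (plane (5 * d' + 7 * b' + 6 * a' + 6 * k + 6 * n) (1 + a')) := by
  rintro rfl
  rw [dist_vec, dist_plane]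
  congr 1
  obtain rfl : d' = 1 - a' - b' := by linarith
  obtain rfl : z' = 1 - y' := by linarith
  ring

theorem dist_bottom_mid {a' b' d' x' y' z' : ℝ} (k n : ℤ) (s' : a' + b' + d' = 1)
    (t' : x' + y' + z' = 1) :
    y' = 0 → dist (vec (-x') (-y') (-z')) (vec (-a') (-b') (-d')) =
      dist (plane (3 * x' + 5 * z' + 6 * k + 6 * n) 1)
        (plane (3 * a' + 5 * d' + 4 * b' + 6 * k + 6 * n) (1 + b')) := by
  rintro rfl
  rw [dist_vec, dist_plane]
  congr 1
  obtain rfl : d' = 1 - a' - b' := by linarith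
  obtain rfl : z' = 1 - x' := by linarith
  ring

theorem dist_bottom_right {a' b' d' x' y' z' : ℝ} (k n : ℤ) (s' : a' + b' + d' = 1)
    (t' : x' + y' + z' = 1) :
    z' = 0 → dist (vec (-x') (-y') (-z')) (vec (-a') (-b') (-d')) =
      dist (plane (y' + 3 * x' + 6 * k + 6 * n) 1)
        (plane (b' + 3 * a' + 2 * d' + 6 * k + 6 * n) (1 + d')) := by
  rintro rfl
  rw [dist_vec, dist_plane]
  congr 1
  obtain rfl : d' = 1 - a' - b' := by linarith
  obtain rfl : y' = 1 - x' := by linarith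
  ring

theorem le_plane_sq {m X ξ ξ' h h' u : ℝ} (j : ℤ)
    (e1 : X ≤ 3 / 4 * (u + 6 * j) ^ 2 + 9 / 4 * (h' - h) ^ 2) (e2 : m ≤ X)
    (e3 : ξ' - ξ = u + 6 * j) : m ≤ 3 / 4 * (ξ - ξ') ^ 2 + 9 / 4 * (h - h') ^ 2 := by
  have : 3 / 4 * (ξ - ξ') ^ 2 + 9 / 4 * (h - h') ^ 2 =
      3 / 4 * (ξ' - ξ) ^ 2 + 9 / 4 * (h' - h) ^ 2 := by ring
  rw [this, e3]
  exact e2.trans e1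

theorem le_length_of_band {a b d a' b' d' x y z x' y' z' m : ℝ}
    (ha : 0 ≤ a) (hb : 0 ≤ b) (hd : 0 ≤ d) (ha' : 0 ≤ a') (hb' : 0 ≤ b') (hd' : 0 ≤ d')
    (s : a + b + d = 1) (s' : a' + b' + d' = 1)
    (hx : 0 ≤ x) (hy : 0 ≤ y) (hz : 0 ≤ z) (t : x + y + z = 1) (t0 : x = 0 ∨ y = 0 ∨ z = 0)
    (hx' : 0 ≤ x') (hy' : 0 ≤ y') (hz' : 0 ≤ z') (t' : x' + y' + z' = 1)
    (t0' : x' = 0 ∨ y' = 0 ∨ z' = 0) {V : ℝ≥0∞}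
    (hV : ∀ u, IsLift (vec x y z) u → ∃ w, IsLift (vec (-x') (-y') (-z')) w ∧ edist u w ≤ V)
    (hm1 : m ≤ 9 / 4 * (1 - a - a') ^ 2 + 3 / 4 * (3 - |(d' - b') - (d - b)|) ^ 2)
    (hm2 : m ≤ 9 / 4 * (1 - b - b') ^ 2 + 3 / 4 * (3 - |(d' - a') - (d - a)|) ^ 2)
    (hm3 : m ≤ 9 / 4 * (1 - d - d') ^ 2 + 3 / 4 * (3 - |(b' - a') - (b - a)|) ^ 2) :
    ENNReal.ofReal √m ≤ edist (vec a b d) (vec x y z) + V +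
      edist (vec (-x') (-y') (-z')) (vec (-a') (-b') (-d')) := by
  have flip : ∀ r r' t t' : ℝ, |(r' - t') - (r - t)| = |(t' - r') - (t - r)| := by
    intro r r' t t'
    rw [← abs_neg]; congr 1; ring
  have hm1' := hm1
  have hm2' := hm2
  have hm3' := hm3
  rw [flip] at hm1' hm2' hm3'
  obtain ⟨ξ₁, hlift, hξ₁⟩ := exists_isLift_of_top hx hy hz t t0
  obtain ⟨w, ⟨_, _, _, n, hw, rfl⟩, hwV⟩ := hV _ hlift
  obtain ⟨rfl, rfl, rfl⟩ := vec_inj.1 hw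
  obtain ⟨k, hk⟩ := exists_angle_of_bottom hx' hy' hz' t' t0'
  have hh : (1 - (-x' + -y' + -z')) / 2 = 1 := by linarith
  rw [hh] at hwV
  -- Nine pairs of edges. For two antipodal edges the unfolding is handled by `translate_le`; the
  -- other six pairs are the strips of four faces and are handled by `glide_le`. The shifts by ±1
  -- compensate for the seam of the angle.
  rcases hξ₁ with ⟨rfl, hz0⟩ | ⟨rfl, hz0⟩ | ⟨rfl, hz0⟩ <;>
    rcases hk with ⟨e, he⟩ | ⟨e, he⟩ | ⟨e, he⟩ <;> rw [e] at hwV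
  · refine development_triangle (dist_top_left s t hz0) hwV (dist_bottom_right k n s' t' he) (le_plane_sq (k + n) (u := -(1 + b' - a' + b - d))
      ((glide_le ha hd hb ha' hd' hb' (by linarith) (by linarith) (k + n) (Or.inr rfl)).trans (le_of_eq ?_)) hm2 (by push_cast; linarith))
    ring
  · refine development_triangle (dist_top_left s t hz0) hwV (dist_bottom_mid k n s' t' he) (le_plane_sq (k + n) (u := 1 + d' - a' + d - b)
      ((glide_le ha hb hd ha' hb' hd' (by linarith) (by linarith) (k + n) (Or.inl rfl)).trans (le_of_eq ?_)) hm3 (by push_cast; linarith))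
    ring
  · refine development_triangle (dist_top_left s t hz0) hwV (dist_bottom_left k n s' t' he) (le_plane_sq (k + n) (u := 3 + ((b' - d') - (b - d)))
      ((translate_le ha ha' (k + n) rfl (by rw [abs_le]; constructor <;> linarith)).trans (le_of_eq ?_)) hm1' (by push_cast; linarith))
    ring
  · refine development_triangle (dist_top_mid s t hz0) hwV (dist_bottom_right k n s' t' he) (le_plane_sq (k + n) (u := 1 + a' - b' + a - d)
      ((glide_le hb hd ha hb' hd' ha' (by linarith) (by linarith) (k + n) (Or.inl rfl)).trans (le_of_eq ?_)) hm1 (by push_cast; linarith))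
    ring
  · refine development_triangle (dist_top_mid s t hz0) hwV (dist_bottom_mid k n s' t' he) (le_plane_sq (k + n) (u := 3 + ((d' - a') - (d - a)))
      ((translate_le hb hb' (k + n) rfl (by rw [abs_le]; constructor <;> linarith)).trans (le_of_eq ?_)) hm2 (by push_cast; linarith))
    ring
  · refine development_triangle (dist_top_mid s t hz0) hwV (dist_bottom_left k n s' t' he) (le_plane_sq (k + n + 1) (u := -(1 + d' - b' + d - a))
      ((glide_le hb ha hd hb' ha' hd' (by linarith) (by linarith) (k + n + 1) (Or.inr rfl)).trans (le_of_eq ?_)) hm3' (by push_cast; linarith))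
    ring
  · refine development_triangle (dist_top_right s t hz0) hwV (dist_bottom_right k n s' t' he) (le_plane_sq (k + n - 1) (u := 3 + ((a' - b') - (a - b)))
      ((translate_le hd hd' (k + n - 1) rfl (by rw [abs_le]; constructor <;> linarith)).trans (le_of_eq ?_)) hm3' (by push_cast; linarith))
    ring
  · refine development_triangle (dist_top_right s t hz0) hwV (dist_bottom_mid k n s' t' he) (le_plane_sq (k + n) (u := -(1 + a' - d' + a - b))
      ((glide_le hd hb ha hd' hb' ha' (by linarith) (by linarith) (k + n) (Or.inr rfl)).trans (le_of_eq ?_)) hm1' (by push_cast; linarith))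
    ring
  · refine development_triangle (dist_top_right s t hz0) hwV (dist_bottom_left k n s' t' he) (le_plane_sq (k + n) (u := 1 + b' - d' + b - a)
      ((glide_le hd ha hb hd' ha' hb' (by linarith) (by linarith) (k + n) (Or.inl rfl)).trans (le_of_eq ?_)) hm2' (by push_cast; linarith))
    ring

theorem le_surfaceDist_opposite {a b d a' b' d' m : ℝ} (ha : 0 ≤ a) (hb : 0 ≤ b) (hd : 0 ≤ d)
    (ha' : 0 ≤ a') (hb' : 0 ≤ b') (hd' : 0 ≤ d') (h h')
    (hm1 : m ≤ 9 / 4 * (1 - a - a') ^ 2 + 3 / 4 * (3 - |(d' - b') - (d - b)|) ^ 2)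
    (hm2 : m ≤ 9 / 4 * (1 - b - b') ^ 2 + 3 / 4 * (3 - |(d' - a') - (d - a)|) ^ 2)
    (hm3 : m ≤ 9 / 4 * (1 - d - d') ^ 2 + 3 / 4 * (3 - |(b' - a') - (b - a)|) ^ 2) :
    ENNReal.ofReal √m ≤ surfaceDist (oct a b d h) (oct (-a') (-b') (-d') h') := by
  have s : a + b + d = 1 := by rwa [abs_of_nonneg ha, abs_of_nonneg hb, abs_of_nonneg hd] at h
  have s' : a' + b' + d' = 1 := by
    rwa [abs_neg, abs_neg, abs_neg, abs_of_nonneg ha', abs_of_nonneg hb', abs_of_nonneg hd'] at h'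
  refine le_iInf fun γ => ?_
  rw [pathLength_eq]
  set g : ℝ → EuclideanSpace ℝ (Fin 3) := fun t => (γ.extend t : EuclideanSpace ℝ (Fin 3))
  have hg : Continuous g := continuous_subtype_val.comp γ.continuous_extend
  have hgs : ∀ τ, g τ ∈ octahedronSurface := fun τ => (γ.extend τ).2
  have g0 : g 0 = vec a b d := congrArg Subtype.val γ.extend_zero
  have g1 : g 1 = vec (-a') (-b') (-d') := congrArg Subtype.val γ.extend_one
  let top : Set (EuclideanSpace ℝ (Fin 3)) := {v | 0 ≤ v 0 ∧ 0 ≤ v 1 ∧ 0 ≤ v 2}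
  let bot : Set (EuclideanSpace ℝ (Fin 3)) := {v | v 0 ≤ 0 ∧ v 1 ≤ 0 ∧ v 2 ≤ 0}
  have htop : IsClosed top := (isClosed_coord_nonneg 0).inter
    ((isClosed_coord_nonneg 1).inter (isClosed_coord_nonneg 2))
  have hbot : IsClosed bot := (isClosed_coord_nonpos 0).inter
    ((isClosed_coord_nonpos 1).inter (isClosed_coord_nonpos 2))
  -- The last time in the top face and then the first time in the bottom face; in between the path
  -- stays in the band, by closedness also at both ends.
  obtain ⟨t₁, ⟨ht₁, h1top⟩, hmax⟩ :=
    (isCompact_Icc.inter_right (htop.preimage hg) :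
      IsCompact (Set.Icc 0 1 ∩ g ⁻¹' top)).exists_isGreatest
      ⟨0, by simp, by
        simp only [Set.mem_preimage, g0, top, Set.mem_ofPred_eq, vec_sign_iff]
        exact ⟨ha, hb, hd⟩⟩
  obtain ⟨t₂, ⟨ht₂, h2bot⟩, hmin⟩ :=
    (isCompact_Icc.inter_right (hbot.preimage hg) :
      IsCompact (Set.Icc t₁ 1 ∩ g ⁻¹' bot)).exists_isLeast
      ⟨1, ⟨ht₁.2, le_rfl⟩, by
        simp only [Set.mem_preimage, g1, bot, Set.mem_ofPred_eq, vec_sign_iff]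
        exact ⟨by linarith, by linarith, by linarith⟩⟩
  obtain ⟨x, y, z, hxyz⟩ := exists_vec (g t₁)
  obtain ⟨x', y', z', hxyz'⟩ : ∃ x' y' z', g t₂ = vec (-x') (-y') (-z') := by
    obtain ⟨x', y', z', e⟩ := exists_vec (g t₂)
    exact ⟨-x', -y', -z', by simpa using e⟩
  obtain ⟨hx, hy, hz⟩ : 0 ≤ x ∧ 0 ≤ y ∧ 0 ≤ z := by
    simpa only [Set.mem_preimage, hxyz, top, Set.mem_ofPred_eq, vec_sign_iff] using h1top
  obtain ⟨hx', hy', hz'⟩ : 0 ≤ x' ∧ 0 ≤ y' ∧ 0 ≤ z' := by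
    simpa only [Set.mem_preimage, hxyz', bot, Set.mem_ofPred_eq, vec_sign_iff, neg_nonpos]
      using h2bot
  have t : x + y + z = 1 := by
    have := hgs t₁
    rwa [hxyz, vec_mem_iff, abs_of_nonneg hx, abs_of_nonneg hy, abs_of_nonneg hz] at this
  have t' : x' + y' + z' = 1 := by
    have := hgs t₂
    rwa [hxyz', vec_mem_iff, abs_neg, abs_neg, abs_neg, abs_of_nonneg hx', abs_of_nonneg hy',
      abs_of_nonneg hz'] at this
  have hlt : t₁ < t₂ := by
    refine lt_of_le_of_ne ht₂.1 ?_
    rintro rfl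
    obtain ⟨e1, e2, e3⟩ := vec_inj.1 (hxyz.symm.trans hxyz')
    linarith
  have hband : Set.Icc t₁ t₂ ⊆ g ⁻¹' ⋃ i, bandFace i := by
    rw [← closure_Ioo hlt.ne]
    refine closure_minimal ?_ ((isClosed_iUnion_of_finite isClosed_bandFace).preimage hg)
    intro τ hτ
    have n1 : g τ ∉ top := fun h => absurd (hmax ⟨⟨ht₁.1.trans hτ.1.le, hτ.2.le.trans ht₂.2⟩, h⟩)
      (not_le.2 hτ.1)
    have n2 : g τ ∉ bot := fun h => absurd (hmin ⟨⟨hτ.1.le, hτ.2.le.trans ht₂.2⟩, h⟩)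
      (not_le.2 hτ.2)
    rw [Set.mem_preimage, Set.mem_iUnion]
    rcases le_total 0 (g τ 0) with c0 | c0 <;> rcases le_total 0 (g τ 1) with c1 | c1 <;>
      rcases le_total 0 (g τ 2) with c2 | c2
    · exact absurd ⟨c0, c1, c2⟩ n1
    · exact ⟨4, hgs τ, c0, c1, c2⟩
    · exact ⟨0, hgs τ, c0, c1, c2⟩
    · exact ⟨5, hgs τ, c0, c1, c2⟩
    · exact ⟨2, hgs τ, c0, c1, c2⟩
    · exact ⟨3, hgs τ, c0, c1, c2⟩
    · exact ⟨1, hgs τ, c0, c1, c2⟩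
    · exact absurd ⟨c0, c1, c2⟩ n2
  have hends : ∀ {X Y Z : ℝ}, vec X Y Z ∈ ⋃ i, bandFace i →
      (X ≤ 0 ∨ Y ≤ 0 ∨ Z ≤ 0) ∧ (0 ≤ X ∨ 0 ≤ Y ∨ 0 ≤ Z) := by
    intro X Y Z hi
    obtain ⟨i, hi⟩ := Set.mem_iUnion.1 hi
    fin_cases i <;>
      simp only [bandFace, Fin.zero_eta, Fin.mk_one, Fin.reduceFinMk, Matrix.cons_val,
        Matrix.cons_val_zero, Matrix.cons_val_one, Set.mem_ofPred_eq, vec_sign_iff] at hi <;>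
      tauto
  have t0 : x = 0 ∨ y = 0 ∨ z = 0 := by
    have := (hends (hxyz ▸ (hband ⟨le_rfl, hlt.le⟩ : g t₁ ∈ _))).1
    rcases this with h | h | h
    · exact Or.inl (le_antisymm h hx)
    · exact Or.inr (Or.inl (le_antisymm h hy))
    · exact Or.inr (Or.inr (le_antisymm h hz))
  have t0' : x' = 0 ∨ y' = 0 ∨ z' = 0 := by
    have := (hends (hxyz' ▸ (hband ⟨hlt.le, le_rfl⟩ : g t₂ ∈ _))).2
    rcases this with h | h | h
    · exact Or.inl (by linarith)
    · exact Or.inr (Or.inl (by linarith))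
    · exact Or.inr (Or.inr (by linarith))
  have hV : ∀ u, IsLift (vec x y z) u → ∃ w, IsLift (vec (-x') (-y') (-z')) w ∧
      edist u w ≤ eVariationOn g (Set.Icc t₁ t₂) := by
    intro u hu
    rw [← hxyz']
    rw [← hxyz] at hu
    exact exists_edist_le_eVariationOn (C := bandFace) (Q := IsLift) Finset.univ
      (fun i _ => isClosed_bandFace i)
      (fun i _ x hx y hy v hv => hv.step_bandFace i hx hy) t₁ hlt.le hg.continuousOn
      (fun τ hτ => by simpa using hband hτ) u hu
  refine (le_length_of_band ha hb hd ha' hb' hd' s s' hx hy hz t t0 hx' hy' hz' t' t0' hV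
    hm1 hm2 hm3).trans ?_
  rw [← g0, ← g1, ← hxyz, ← hxyz']
  have e1 := eVariationOn.Icc_add_Icc g (s := Set.univ) ht₁.1 ht₁.2 (Set.mem_univ _)
  have e2 := eVariationOn.Icc_add_Icc g (s := Set.univ) hlt.le ht₂.2 (Set.mem_univ _)
  simp only [Set.univ_inter] at e1 e2
  rw [← e1, ← e2, ← add_assoc]
  gcongr
  · exact eVariationOn.edist_le _ ⟨le_rfl, ht₁.1⟩ ⟨ht₁.1, le_rfl⟩
  · exact eVariationOn.edist_le _ ⟨le_rfl, ht₂.2⟩ ⟨ht₂.2, le_rfl⟩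

/-! ### Upper bounds for the distance -/

theorem lt_ofReal_sqrt {D : ℝ≥0∞} {V R : ℝ} (h : D ≤ ENNReal.ofReal √V) (hV : V < R)
    (hR : 0 < R) : D < ENNReal.ofReal √R :=
  h.trans_lt ((ENNReal.ofReal_lt_ofReal_iff (Real.sqrt_pos.2 hR)).2
    ((Real.sqrt_lt_sqrt_iff_of_pos hR).2 hV))

theorem surfaceDist_le_first {a b d a' b' d' : ℝ} (ha : 0 ≤ a) (hb : 0 ≤ b) (hd : 0 ≤ d)
    (ha' : 0 ≤ a') (hb' : 0 ≤ b') (hd' : 0 ≤ d') (h h') :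
    surfaceDist (oct a b d h) (oct a' b' d' h') ≤
      ENNReal.ofReal √(3 / 4 * (b + 2 * d - (b' + 2 * d')) ^ 2 + 9 / 4 * (b - b') ^ 2) := by
  have s : a + b + d = 1 := by rwa [abs_of_nonneg ha, abs_of_nonneg hb, abs_of_nonneg hd] at h
  have s' : a' + b' + d' = 1 := by
    rwa [abs_of_nonneg ha', abs_of_nonneg hb', abs_of_nonneg hd'] at h'
  have e := (rollUp_first (ξ := b + 2 * d) (h := b) hb (by linarith) (by linarith)).trans
    (oct_inj.2 ⟨by linarith, by linarith, by linarith⟩ : _ = oct a b d h)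
  have e' := (rollUp_first (ξ := b' + 2 * d') (h := b') hb' (by linarith) (by linarith)).trans
    (oct_inj.2 ⟨by linarith, by linarith, by linarith⟩ : _ = oct a' b' d' h')
  rw [← e, ← e']
  apply surfaceDist_rollUp_le <;> linarith

theorem surfaceDist_lt_first {a b d a' b' d' R : ℝ} (ha : 0 ≤ a) (hb : 0 ≤ b) (hd : 0 ≤ d)
    (ha' : 0 ≤ a') (hb' : 0 ≤ b') (hd' : 0 ≤ d') (h h') (hR : 3 < R) :
    surfaceDist (oct a b d h) (oct a' b' d' h') < ENNReal.ofReal √R := by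
  have s : a + b + d = 1 := by rwa [abs_of_nonneg ha, abs_of_nonneg hb, abs_of_nonneg hd] at h
  have s' : a' + b' + d' = 1 := by
    rwa [abs_of_nonneg ha', abs_of_nonneg hb', abs_of_nonneg hd'] at h'
  refine lt_ofReal_sqrt (surfaceDist_le_first ha hb hd ha' hb' hd' h h') (lt_of_le_of_lt ?_ hR)
    (by linarith)
  obtain rfl : a = 1 - b - d := by linarith
  obtain rfl : a' = 1 - b' - d' := by linarith
  nlinarith [mul_nonneg hb hb', mul_nonneg hd hd', mul_nonneg ha ha', mul_nonneg hb hd,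
    mul_nonneg ha hb, mul_nonneg ha hd, mul_nonneg hb' hd', mul_nonneg ha' hb', mul_nonneg ha' hd']

/-- On an adjacent face, it suffices to look at the vertex off the common edge. -/
theorem surfaceDist_lt_second {a b d a' b' d' R : ℝ} (ha : 0 ≤ a) (hb : 0 ≤ b) (hd : 0 ≤ d)
    (ha' : 0 ≤ a') (hb' : 0 ≤ b') (hd' : 0 ≤ d') (h h') (hR : 3 < R) (ha1 : a' < 1)
    (hF : 3 / 4 * (b + 2 * d - 3) ^ 2 + 9 / 4 * (b - 1) ^ 2 ≤ R) :
    surfaceDist (oct a b d h) (oct (-a') b' d' h') < ENNReal.ofReal √R := by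
  have s : a + b + d = 1 := by rwa [abs_of_nonneg ha, abs_of_nonneg hb, abs_of_nonneg hd] at h
  have s' : a' + b' + d' = 1 := by
    rwa [abs_neg, abs_of_nonneg ha', abs_of_nonneg hb', abs_of_nonneg hd'] at h'
  refine lt_ofReal_sqrt (surfaceDist_le_second ha hb hd ha' hb' hd' h h') ?_ (by linarith)
  -- The squared distance at a point of a triangle is the weighted mean of its values at the
  -- vertices minus 3, the squared edge length, times the pairwise products of the weights.
  have h1 : 3 / 4 * (b + 2 * d - (b' + 2 * d' + 3 * a')) ^ 2 + 9 / 4 * (b - (a' + b')) ^ 2 =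
      a' * (3 / 4 * (b + 2 * d - 3) ^ 2 + 9 / 4 * (b - 1) ^ 2) +
      b' * (3 / 4 * (b + 2 * d - 1) ^ 2 + 9 / 4 * (b - 1) ^ 2) +
      d' * (3 / 4 * (b + 2 * d - 2) ^ 2 + 9 / 4 * b ^ 2) - 3 * (a' * b' + a' * d' + b' * d') := by
    obtain rfl : a' = 1 - b' - d' := by linarith
    ring
  have h2 : 3 / 4 * (b + 2 * d - 1) ^ 2 + 9 / 4 * (b - 1) ^ 2 ≤ 3 := by
    obtain rfl : a = 1 - b - d := by linarith
    nlinarith [mul_nonneg hb hd, mul_nonneg ha hd, mul_nonneg ha hb]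
  have h3 : 3 / 4 * (b + 2 * d - 2) ^ 2 + 9 / 4 * b ^ 2 ≤ 3 := by
    obtain rfl : a = 1 - b - d := by linarith
    nlinarith [mul_nonneg hb hd, mul_nonneg ha hd, mul_nonneg ha hb]
  have h4 : 0 < b' + d' := by linarith
  have h5 : 0 ≤ a' * b' + a' * d' + b' * d' := by positivity
  rw [h1]
  have e1 := mul_le_mul_of_nonneg_left hF ha'
  have e2 := mul_le_mul_of_nonneg_left h2 hb'
  have e3 := mul_le_mul_of_nonneg_left h3 hd'
  have e4 : 0 < (b' + d') * (R - 3) := mul_pos h4 (by linarith)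
  have e5 : a' * R + (b' + d') * R = R := by rw [← add_mul, ← add_assoc, s', one_mul]
  linarith

/-- On a face which meets the given one in a vertex, it suffices to look at the opposite edge. -/
theorem surfaceDist_lt_third {a b d a' b' d' R l : ℝ} (ha : 0 ≤ a) (hb : 0 ≤ b) (hd : 0 ≤ d)
    (ha' : 0 ≤ a') (hb' : 0 ≤ b') (hd' : 0 < d') (h h') (hR : 3 < R)
    (hl : b' = (1 - d') * l)
    (hF : 3 / 4 * (b + 2 * d - 3 - l) ^ 2 + 9 / 4 * (b - 1 + l) ^ 2 ≤ R) :
    surfaceDist (oct a b d h) (oct (-a') (-b') d' h') < ENNReal.ofReal √R := by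
  have s : a + b + d = 1 := by rwa [abs_of_nonneg ha, abs_of_nonneg hb, abs_of_nonneg hd] at h
  have s' : a' + b' + d' = 1 := by
    rwa [abs_neg, abs_neg, abs_of_nonneg ha', abs_of_nonneg hb', abs_of_nonneg hd'.le] at h'
  refine lt_ofReal_sqrt (surfaceDist_le_third ha hb hd ha' hb' hd'.le h h') ?_ (by linarith)
  have h3 : 3 / 4 * (b + 2 * d - 2) ^ 2 + 9 / 4 * b ^ 2 ≤ 3 := by
    obtain rfl : a = 1 - b - d := by linarith
    nlinarith [mul_nonneg hb hd, mul_nonneg ha hd, mul_nonneg ha hb]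
  have h1 : 3 / 4 * (b + 2 * d - (2 * d' + 3 * a' + 4 * b')) ^ 2 + 9 / 4 * (b - a') ^ 2 =
      d' * (3 / 4 * (b + 2 * d - 2) ^ 2 + 9 / 4 * b ^ 2) +
      (1 - d') * (3 / 4 * (b + 2 * d - 3 - l) ^ 2 + 9 / 4 * (b - 1 + l) ^ 2) -
      d' * (1 - d') * (3 / 4 * (1 + l) ^ 2 + 9 / 4 * (1 - l) ^ 2) := by
    obtain rfl : a' = 1 - b' - d' := by linarith
    subst hl
    ring
  have hd1 : 0 ≤ 1 - d' := by linarith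
  rw [h1]
  have e1 := mul_le_mul_of_nonneg_left h3 hd'.le
  have e2 := mul_le_mul_of_nonneg_left hF hd1
  have e3 : 0 ≤ d' * (1 - d') * (3 / 4 * (1 + l) ^ 2 + 9 / 4 * (1 - l) ^ 2) := by positivity
  have e4 : 0 < d' * (R - 3) := mul_pos hd' (by linarith)
  linarith

/-- The common vertex can be passed on either side. Coning from it, it is enough that each point `l`
of the opposite edge is close in one of the two developments; exchanging `a` and `b` turns `l` into
`1 - l`. -/
theorem surfaceDist_lt_third_of_edge {a b d a' b' d' R : ℝ} (ha : 0 ≤ a) (hb : 0 ≤ b) (hd : 0 ≤ d)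
    (ha' : 0 ≤ a') (hb' : 0 ≤ b') (hd' : 0 < d') (h h') (hR : 3 < R)
    (hF : ∀ l : ℝ, 0 ≤ l → l ≤ 1 → 3 / 4 * (b + 2 * d - 3 - l) ^ 2 + 9 / 4 * (b - 1 + l) ^ 2 ≤ R ∨
      3 / 4 * (a + 2 * d - 4 + l) ^ 2 + 9 / 4 * (a - l) ^ 2 ≤ R) :
    surfaceDist (oct a b d h) (oct (-a') (-b') d' h') < ENNReal.ofReal √R := by
  have s' : a' + b' + d' = 1 := by
    rwa [abs_neg, abs_neg, abs_of_nonneg ha', abs_of_nonneg hb', abs_of_nonneg hd'.le] at h'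
  obtain ⟨l, hl0, hl1, hl⟩ : ∃ l : ℝ, 0 ≤ l ∧ l ≤ 1 ∧ b' = (1 - d') * l := by
    rcases (by linarith : d' ≤ 1).eq_or_lt with rfl | h1
    -- Here the target is the common vertex itself and any `l` serves.
    · exact ⟨0, le_rfl, zero_le_one, by linarith⟩
    · have : 0 < 1 - d' := by linarith
      refine ⟨b' / (1 - d'), by positivity, by rw [div_le_one this]; linarith, ?_⟩
      field_simp
  rcases hF l hl0 hl1 with hF | hF
  · exact surfaceDist_lt_third ha hb hd ha' hb' hd' h h' hR hl hF
  · rw [surfaceDist_swap_left]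
    refine surfaceDist_lt_third (l := 1 - l) hb ha hd hb' ha' hd' _ _ hR ?_ ?_
    · linarith
    · refine le_trans (le_of_eq ?_) hF
      ring

theorem surfaceDist_le_opposite_mid {a b d a' b' d' : ℝ} (ha : 0 ≤ a) (hb : 0 ≤ b) (hd : 0 ≤ d)
    (ha' : 0 ≤ a') (hb' : 0 ≤ b') (hd' : 0 ≤ d') (h h') :
    surfaceDist (oct a b d h) (oct (-a') (-b') (-d') h') ≤
      ENNReal.ofReal √(9 / 4 * (1 - b - b') ^ 2 + 3 / 4 * (3 - |(d' - a') - (d - a)|) ^ 2) := by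
  rcases abs_cases ((d' - a') - (d - a)) with ⟨e, _⟩ | ⟨e, _⟩ <;> rw [e]
  · rw [surfaceDist_swap_left, surfaceDist_swap_right, surfaceDist_swap_left]
    refine (surfaceDist_le_fourth hd hb ha hd' hb' ha' _ _).trans (le_of_eq ?_)
    congr 2; ring
  · refine (surfaceDist_le_fourth ha hb hd ha' hb' hd' _ _).trans (le_of_eq ?_)
    congr 2; ring

theorem surfaceDist_le_opposite_left {a b d a' b' d' : ℝ} (ha : 0 ≤ a) (hb : 0 ≤ b) (hd : 0 ≤ d)
    (ha' : 0 ≤ a') (hb' : 0 ≤ b') (hd' : 0 ≤ d') (h h') :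
    surfaceDist (oct a b d h) (oct (-a') (-b') (-d') h') ≤
      ENNReal.ofReal √(9 / 4 * (1 - a - a') ^ 2 + 3 / 4 * (3 - |(d' - b') - (d - b)|) ^ 2) := by
  rw [surfaceDist_swap_left]
  exact surfaceDist_le_opposite_mid hb ha hd hb' ha' hd' _ _

/-! ### The fundamental triangle -/

/-- The triangle spanned by the cube roots of unity, in the coordinates `x` and `Y = √3 y`. -/
structure InFace (x Y : ℝ) : Prop where
  left : 0 ≤ 1 + 2 * x
  lower : 0 ≤ 1 - x + Y
  upper : 0 ≤ 1 - x - Y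

/-- The fundamental triangle, in the coordinates `x` and `Y = √3 y`. -/
structure InT (x Y : ℝ) : Prop where
  nonneg : 0 ≤ Y
  left : Y ≤ 3 * x
  right : x + Y ≤ 1

theorem InT.inFace {x Y : ℝ} (h : InT x Y) : InFace x Y := by
  obtain ⟨h1, h2, h3⟩ := h
  constructor <;> linarith

theorem InFace.abs_sum {x Y : ℝ} (h : InFace x Y) :
    |(1 + 2 * x) / 3| + |(1 - x + Y) / 3| + |(1 - x - Y) / 3| = 1 := by
  obtain ⟨h1, h2, h3⟩ := h
  rw [abs_of_nonneg (by linarith), abs_of_nonneg (by linarith), abs_of_nonneg (by linarith)]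
  ring

open Classical in
/-- The point with coordinates `x` and `Y = √3 y` on the face which contains `T`. -/
noncomputable def facePoint (x Y : ℝ) : Octahedron :=
  if h : InFace x Y then oct _ _ _ h.abs_sum else oct 1 0 0 (by simp)

theorem facePoint_eq {x Y : ℝ} (h : InFace x Y) : facePoint x Y = oct _ _ _ h.abs_sum :=
  dif_pos h

theorem facePoint_inj {x Y x' Y' : ℝ} (h : InFace x Y) (h' : InFace x' Y') :
    facePoint x Y = facePoint x' Y' ↔ x = x' ∧ Y = Y' := by
  rw [facePoint_eq h, facePoint_eq h', oct_inj]
  constructor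
  · rintro ⟨h1, h2, h3⟩; constructor <;> linarith
  · rintro ⟨rfl, rfl⟩; simp

theorem adjacent_vertex_le {x Y : ℝ} (hx : 0 ≤ x) (hx1 : x ≤ 1) (hY : -(3 / 4) ≤ Y)
    (hY' : Y ≤ 3 / 4) : (x - 1) ^ 2 + (Y + 3) ^ 2 / 3 ≤ 27 / 4 := by
  have h1 : (x - 1) ^ 2 ≤ 1 ^ 2 := sq_le_sq' (by linarith) (by linarith)
  have h2 : (Y + 3) ^ 2 ≤ (15 / 4) ^ 2 := sq_le_sq' (by linarith) (by linarith)
  linarith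

/-- The edge `l ↦ (1 - l) X⁻ + l Y⁻` in the two developments around `Z⁺`. -/
theorem edge_le {x Y l R : ℝ} (hx : 0 ≤ x) (h2 : Y ≤ 3 * x) (h3 : x + Y ≤ 1)
    (h4 : -Y ≤ 1 - x) (hY : -(3 / 4) ≤ Y) (hl0 : 0 ≤ l) (hl1 : l ≤ 1) (hR : 27 / 4 ≤ R)
    (hR' : 1 / 4 ≤ x → 4 * x ^ 2 - 2 * x + 7 ≤ R) :
    (x + 2) ^ 2 + (Y + 3 * l) ^ 2 / 3 ≤ R ∨
      (x + 1 / 2 - 3 * l / 2) ^ 2 + (Y + 9 / 2 - 3 * l / 2) ^ 2 / 3 ≤ R := by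
  have hden : 0 < x + Y + 2 := by linarith
  -- Up to the value of `l` where the two developments agree, the first is controlled: with Y + 3l ≤
  -- 3(1 - x) it is at most 4x² - 2x + 7, and for x ≤ 1/4 the bound l ≤ 1/2 gives 27/4.
  have first : ∀ l : ℝ, 0 ≤ l → l * (x + Y + 2) ≤ 1 - x + Y →
      (x + 2) ^ 2 + (Y + 3 * l) ^ 2 / 3 ≤ R := by
    intro l hl0 hl
    rcases le_or_gt (1 / 4) x with hx4 | hx4
    · have e1 : Y + 3 * l ≤ 3 * (1 - x) := by
        have : (3 * l) * (x + Y + 2) ≤ (3 - 3 * x - Y) * (x + Y + 2) := by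
          have := mul_nonneg (by linarith : 0 ≤ 1 - x - Y) (by linarith : 0 ≤ 3 + 3 * x + Y)
          linarith
        have := le_of_mul_le_mul_right this hden
        linarith
      have e2 : (Y + 3 * l) ^ 2 ≤ (3 * (1 - x)) ^ 2 := sq_le_sq' (by linarith) e1
      have := hR' hx4
      linarith
    · have e1 : l ≤ 1 / 2 := by
        by_contra hc
        have := mul_lt_mul_of_pos_right (not_le.1 hc) hden
        linarith
      have e2 : (Y + 3 * l) ^ 2 ≤ (3 * x + 3 / 2) ^ 2 := sq_le_sq' (by linarith) (by linarith)
      have e3 : x * x ≤ x * (1 / 4) := mul_le_mul_of_nonneg_left hx4.le hx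
      linarith
  rcases le_total (l * (x + Y + 2)) (1 - x + Y) with hl | hl
  · exact Or.inl (first l hl0 hl)
  · right
    -- The developments agree at `m`. From there to 1 the second one is convex in `l`, so its values
    -- at `m` and at 1 bound it.
    obtain ⟨m, hm⟩ : ∃ m, m * (x + Y + 2) = 1 - x + Y := ⟨(1 - x + Y) / (x + Y + 2), by field_simp⟩
    have hm0 : 0 ≤ m := nonneg_of_mul_nonneg_left (by linarith) hden
    have hml : m ≤ l := le_of_mul_le_mul_right (hm.trans_le hl) hden
    have f1 := first m hm0 hm.le
    have f2 : (x + 1 / 2 - 3 * m / 2) ^ 2 + (Y + 9 / 2 - 3 * m / 2) ^ 2 / 3 ≤ R := by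
      refine le_trans (le_of_eq ?_) f1
      linear_combination -3 * hm
    have f3 : (x + 1 / 2 - 3 * 1 / 2) ^ 2 + (Y + 9 / 2 - 3 * 1 / 2) ^ 2 / 3 ≤ R := by
      have := adjacent_vertex_le hx (by linarith) hY (by linarith)
      linarith
    have hm1 : m < 1 := by
      by_contra hc
      have := mul_le_mul_of_nonneg_right (not_lt.1 hc) hden.le
      linarith
    have e1 := mul_le_mul_of_nonneg_left f2 (by linarith : 0 ≤ 1 - l)
    have e2 := mul_le_mul_of_nonneg_left f3 (by linarith : 0 ≤ l - m)
    have e3 : 0 ≤ 3 * (l - m) * (1 - l) * (1 - m) :=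
      mul_nonneg (mul_nonneg (by linarith) (by linarith)) (by linarith)
    refine le_of_mul_le_mul_left ?_ (by linarith : 0 < 1 - m)
    linarith

/-- The conditions on `R` are what the right candidate provides: 27/4 is the minimum of `heightSq
x`, and 4x² - 2x + 7 is its value at e = 0, which a step to the right does not decrease once x ≥
1/4. -/
theorem surfaceDist_lt_of_not_opposite {x Y R a b d : ℝ} (hT : InT x Y) (h)
    (hpos : 0 < a ∨ 0 < b ∨ 0 < d) (hR : 27 / 4 ≤ R)
    (hR' : 1 / 4 ≤ x → 4 * x ^ 2 - 2 * x + 7 ≤ R) :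
    surfaceDist (facePoint x Y) (oct a b d h) < ENNReal.ofReal √R := by
  have hF := hT.inFace
  obtain ⟨hY, hl, hr⟩ := hT
  obtain ⟨f1, f2, f3⟩ := hF
  have hx : 0 ≤ x := by linarith
  have hx1 : x ≤ 1 := by linarith
  have hY1 : Y ≤ 3 / 4 := by linarith
  have hR3 : 3 < R := by linarith
  have hxx : x * x ≤ x * 1 := mul_le_mul_of_nonneg_left hx1 hx
  have hYY : Y * Y ≤ Y * (3 / 4) := mul_le_mul_of_nonneg_left hY1 hY
  rw [facePoint_eq ⟨f1, f2, f3⟩]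
  have p1 : 0 ≤ (1 + 2 * x) / 3 := by linarith
  have p2 : 0 ≤ (1 - x + Y) / 3 := by linarith
  have p3 : 0 ≤ (1 - x - Y) / 3 := by linarith
  rcases le_total 0 a with ha | ha <;> rcases le_total 0 b with hb | hb <;>
    rcases le_total 0 d with hd | hd
  · exact surfaceDist_lt_first p1 p2 p3 ha hb hd _ _ hR3
  · obtain ⟨d, rfl⟩ : ∃ d', d = -d' := ⟨-d, by ring⟩
    have hd' : 0 ≤ d := by linarith
    have s := h
    rw [abs_neg, abs_of_nonneg ha, abs_of_nonneg hb, abs_of_nonneg hd'] at s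
    rw [surfaceDist_swap_right, surfaceDist_swap_left]
    refine surfaceDist_lt_second p3 p1 p2 hd' ha hb _ _ hR3 ?_ ?_
    · rcases hpos with h | h | h <;> linarith
    · have := adjacent_vertex_le hx hx1 (by linarith : -(3 / 4) ≤ -Y) (by linarith)
      linarith
  · obtain ⟨b, rfl⟩ : ∃ b', b = -b' := ⟨-b, by ring⟩
    have hb' : 0 ≤ b := by linarith
    have s := h
    rw [abs_neg, abs_of_nonneg ha, abs_of_nonneg hb', abs_of_nonneg hd] at s
    rw [surfaceDist_swap_left]
    refine surfaceDist_lt_second p2 p1 p3 hb' ha hd _ _ hR3 ?_ ?_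
    · rcases hpos with h | h | h <;> linarith
    · have := adjacent_vertex_le hx hx1 (by linarith : -(3 / 4) ≤ Y) hY1
      linarith
  · obtain ⟨b, rfl⟩ : ∃ b', b = -b' := ⟨-b, by ring⟩
    obtain ⟨d, rfl⟩ : ∃ d', d = -d' := ⟨-d, by ring⟩
    have ha' : 0 < a := by rcases hpos with h | h | h <;> linarith
    rw [surfaceDist_swap_left, surfaceDist_swap_right]
    refine surfaceDist_lt_third_of_edge p2 p3 p1 (by linarith) (by linarith) ha' _ _ hR3 ?_
    intro l hl0 hl1
    -- The sum of the two squared lengths is convex in `l` and at most 27/2 at both ends, so they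
    -- cannot both exceed 27/4.
    by_contra! hc
    have e1 : 0 ≤ l * (1 - l) := mul_nonneg hl0 (by linarith)
    have e2 : 2 * x ^ 2 - 7 * x + 11 + 2 * Y ^ 2 / 3 + Y ≤ 27 / 2 := by linarith
    have e3 : 2 * x ^ 2 - 7 * x + 11 + 2 * Y ^ 2 / 3 - Y ≤ 27 / 2 := by linarith
    have e4 := mul_le_mul_of_nonneg_left e2 (by linarith : 0 ≤ 1 - l)
    have e5 := mul_le_mul_of_nonneg_left e3 hl0
    linarith [hc.1, hc.2]
  · obtain ⟨a, rfl⟩ : ∃ a', a = -a' := ⟨-a, by ring⟩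
    have ha' : 0 ≤ a := by linarith
    have s := h
    rw [abs_neg, abs_of_nonneg ha', abs_of_nonneg hb, abs_of_nonneg hd] at s
    refine surfaceDist_lt_second p1 p2 p3 ha' hb hd _ _ hR3 ?_ ?_
    · rcases hpos with h | h | h <;> linarith
    · rcases le_or_gt (1 / 4) x with hx4 | hx4
      · refine le_trans ?_ (hR' hx4)
        have := mul_nonneg (by linarith : 0 ≤ 1 - x - Y) (by linarith : 0 ≤ 1 - x + Y)
        linarith [sq_nonneg (1 - x)]
      · have : x * x ≤ x * (1 / 4) := mul_le_mul_of_nonneg_left hx4.le hx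
        linarith
  · obtain ⟨a, rfl⟩ : ∃ a', a = -a' := ⟨-a, by ring⟩
    obtain ⟨d, rfl⟩ : ∃ d', d = -d' := ⟨-d, by ring⟩
    have hb' : 0 < b := by rcases hpos with h | h | h <;> linarith
    rw [surfaceDist_swap_right]
    refine surfaceDist_lt_third_of_edge p1 p3 p2 (by linarith) (by linarith) hb' _ _ hR3 ?_
    intro l hl0 hl1
    rcases edge_le (x := x) (Y := -Y) (l := l) hx (by linarith) (by linarith) (by linarith)
      (by linarith) hl0 hl1 hR hR' with h | h
    · left; linarith
    · right; linarith
  · obtain ⟨a, rfl⟩ : ∃ a', a = -a' := ⟨-a, by ring⟩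
    obtain ⟨b, rfl⟩ : ∃ b', b = -b' := ⟨-b, by ring⟩
    have hd' : 0 < d := by rcases hpos with h | h | h <;> linarith
    refine surfaceDist_lt_third_of_edge p1 p2 p3 (by linarith) (by linarith) hd' _ _ hR3 ?_
    intro l hl0 hl1
    rcases edge_le (x := x) (Y := Y) (l := l) hx (by linarith) (by linarith) (by linarith)
      (by linarith) hl0 hl1 hR hR' with h | h
    · left; linarith
    · right; linarith
  · rcases hpos with h | h | h <;> linarith

/-! ### The two candidates for the farthest point -/

/-- The horizontal displacement of the candidate on the right. -/
noncomputable def stepRight (x Y : ℝ) : ℝ := (3 * x - Y) * (1 - x - Y) / (3 * x + Y + 3)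

/-- The horizontal displacement of the candidate on the left. -/
noncomputable def stepLeft (x Y : ℝ) : ℝ := -((3 * x - Y) * (1 - x - Y) / (6 - 3 * x - Y))

/-- The squared distance of a point to its horizontal displacement by `e` on the opposite face. -/
noncomputable def heightSq (x e : ℝ) : ℝ := (2 * x + e - 1 / 2) ^ 2 + 27 / 4

theorem InT.x_nonneg {x Y : ℝ} (hT : InT x Y) : 0 ≤ x := by linarith [hT.nonneg, hT.left]

theorem InT.x_le_one {x Y : ℝ} (hT : InT x Y) : x ≤ 1 := by linarith [hT.nonneg, hT.right]

theorem InT.Y_le {x Y : ℝ} (hT : InT x Y) : Y ≤ 3 / 4 := by linarith [hT.left, hT.right]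

theorem InT.prod_nonneg {x Y : ℝ} (hT : InT x Y) : 0 ≤ (3 * x - Y) * (1 - x - Y) :=
  mul_nonneg (by linarith [hT.left]) (by linarith [hT.right])

theorem stepRight_mul {x Y : ℝ} (hT : InT x Y) : stepRight x Y * (3 * x + Y + 3) = (3 * x - Y) * (1 - x - Y) :=
  div_mul_cancel₀ _ (by linarith [hT.x_nonneg, hT.nonneg] : 0 < 3 * x + Y + 3).ne'

theorem stepLeft_mul {x Y : ℝ} (hT : InT x Y) : stepLeft x Y * (6 - 3 * x - Y) = -((3 * x - Y) * (1 - x - Y)) := by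
  rw [stepLeft, neg_mul,
    div_mul_cancel₀ _ (by linarith [hT.x_le_one, hT.right] : 0 < 6 - 3 * x - Y).ne']

theorem stepRight_nonneg {x Y : ℝ} (hT : InT x Y) : 0 ≤ stepRight x Y :=
  div_nonneg hT.prod_nonneg (by linarith [hT.x_nonneg, hT.nonneg])

theorem stepLeft_nonpos {x Y : ℝ} (hT : InT x Y) : stepLeft x Y ≤ 0 :=
  neg_nonpos.2 (div_nonneg hT.prod_nonneg (by linarith [hT.x_le_one, hT.right]))

theorem stepRight_le {x Y : ℝ} (hT : InT x Y) : stepRight x Y ≤ 1 - x - Y := by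
  have hx := hT.x_nonneg
  obtain ⟨h0, h1, h2⟩ := hT
  rw [stepRight, div_le_iff₀ (by linarith), mul_comm]
  exact mul_le_mul_of_nonneg_left (by linarith) (by linarith)

theorem le_stepLeft {x Y : ℝ} (hT : InT x Y) : -((3 * x - Y) / 3) ≤ stepLeft x Y := by
  have hx := hT.x_le_one
  obtain ⟨h0, h1, h2⟩ := hT
  rw [stepLeft, neg_le_neg_iff, mul_div_assoc, div_eq_mul_one_div (3 * x - Y) 3]
  refine mul_le_mul_of_nonneg_left ?_ (by linarith)
  rw [div_le_div_iff₀ (by linarith) (by norm_num)]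
  linarith

theorem neg_stepLeft_le {x Y : ℝ} (hT : InT x Y) : -stepLeft x Y ≤ 1 / 4 := by
  have hx := hT.x_le_one
  have hx0 := hT.x_nonneg
  obtain ⟨h0, h1, h2⟩ := hT
  rw [stepLeft, neg_neg, div_le_iff₀ (by linarith)]
  have e1 : (3 * x - Y) * (1 - x - Y) ≤ 3 * x * (1 - x) :=
    mul_le_mul (by linarith) (by linarith) (by linarith) (by linarith)
  nlinarith [sq_nonneg (2 * x - 1)]

theorem InT.stepRight {x Y : ℝ} (hT : InT x Y) : InT (x + stepRight x Y) Y := by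
  have h1 := stepRight_nonneg hT
  have h2 := stepRight_le hT
  obtain ⟨h3, h4, h5⟩ := hT
  constructor <;> linarith

theorem InT.stepLeft {x Y : ℝ} (hT : InT x Y) : InT (x + stepLeft x Y) Y := by
  have h1 := stepLeft_nonpos hT
  have h2 := le_stepLeft hT
  obtain ⟨h3, h4, h5⟩ := hT
  constructor <;> linarith

/-- Needed for displacements (r + s, -t) with r the right step. The bounds used there for the two
developments agree where s(3x + Y + 3) = (5 + x - Y)t, and the inequality says that their common
linear part is not positive on that ray. -/
theorem stepRight_slope {x Y : ℝ} (hT : InT x Y) :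
    (5 + x - Y) * (3 * x + Y + stepRight x Y) ≤
      (3 - (1 - x + Y - stepRight x Y) / 3) * (3 * x + Y + 3) := by
  have hD : 0 < 3 * x + Y + 3 := by linarith [hT.x_nonneg, hT.nonneg]
  have he := stepRight_mul hT
  have hu : 0 ≤ 3 * x - Y := by linarith [hT.left]
  have hv : 0 ≤ 1 - x - Y := by linarith [hT.right]
  have hY := hT.nonneg
  refine le_of_mul_le_mul_right ?_ hD
  -- The difference of the two sides, made homogeneous by (3x - Y) + 3(1 - x - Y) + 4Y = 3, is this
  -- cubic form with positive coefficients.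
  have key : 0 ≤ 16 / 3 * ((3 * x - Y) ^ 2 * Y) + 16 / 3 * ((3 * x - Y) ^ 2 * (1 - x - Y)) +
      56 * ((3 * x - Y) * (1 - x - Y) * Y) + 22 * ((3 * x - Y) * (1 - x - Y) ^ 2) +
      32 * ((3 * x - Y) * Y ^ 2) + 120 * ((1 - x - Y) * Y ^ 2) + 96 * ((1 - x - Y) ^ 2 * Y) +
      48 * Y ^ 3 + 24 * (1 - x - Y) ^ 3 := by positivity
  have h1 : (5 + x - Y) * (3 * x + Y + stepRight x Y) * (3 * x + Y + 3) =
      (5 + x - Y) * ((3 * x + Y) * (3 * x + Y + 3) + (3 * x - Y) * (1 - x - Y)) := by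
    rw [← he]; ring
  have h2 : (3 - (1 - x + Y - stepRight x Y) / 3) * (3 * x + Y + 3) =
      (8 + x - Y) / 3 * (3 * x + Y + 3) + (3 * x - Y) * (1 - x - Y) / 3 := by
    rw [← he]; ring
  rw [h1, h2]
  linarith

theorem sq_le_of_between {c e e₁ e₂ K : ℝ} (h1 : e₁ ≤ e) (h2 : e ≤ e₂) (k1 : (c + e₁) ^ 2 ≤ K)
    (k2 : (c + e₂) ^ 2 ≤ K) : (c + e) ^ 2 ≤ K := by
  rcases le_total 0 (c + e) with h | h
  · exact le_trans (by nlinarith) k2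
  · exact le_trans (by nlinarith) k1

theorem sq_lt_of_between {c e e₁ e₂ K : ℝ} (h1 : e₁ < e) (h2 : e < e₂) (k1 : (c + e₁) ^ 2 ≤ K)
    (k2 : (c + e₂) ^ 2 ≤ K) : (c + e) ^ 2 < K := by
  rcases le_total 0 (c + e) with h | h
  · exact lt_of_lt_of_le (by nlinarith) k2
  · exact lt_of_lt_of_le (by nlinarith) k1

theorem sub_abs_sq_le_sub {c t : ℝ} (hc : 0 ≤ c) : (c - |t|) ^ 2 ≤ (c - t) ^ 2 := by
  rcases abs_cases t with ⟨h, _⟩ | ⟨h, _⟩ <;> rw [h]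
  nlinarith

/-- Beyond the candidate on the right, one of two developments gives a smaller distance. -/
theorem lt_of_stepRight_lt {x Y e n : ℝ} (hT : InT x Y) (hF : InFace (x + e) (Y + n))
    (he : stepRight x Y < e) :
    (2 * x + e - 1 / 2) ^ 2 + (9 / 2 - |n|) ^ 2 / 3 < heightSq x (stepRight x Y) ∨
      ((2 * Y + n - 2 * x - e - 1) / 2) ^ 2 + (9 / 2 - |3 * e + n| / 2) ^ 2 / 3 <
        heightSq x (stepRight x Y) := by
  have hD : 0 < 3 * x + Y + 3 := by linarith [hT.x_nonneg, hT.nonneg]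
  have hm := stepRight_mul hT
  have hr0 := stepRight_nonneg hT
  have hr1 := stepRight_le hT
  have hK := stepRight_slope hT
  have hx0 := hT.x_nonneg
  have hx1 := hT.x_le_one
  have hY1 := hT.Y_le
  obtain ⟨hY0, hl, hr⟩ := hT
  obtain ⟨f1, f2, f3⟩ := hF
  set r := stepRight x Y
  obtain ⟨s, rfl⟩ : ∃ s, e = r + s := ⟨e - r, by ring⟩
  have hs : 0 < s := by linarith
  unfold heightSq
  have m2 : ((2 * Y + n - 2 * x - (r + s) - 1) / 2) ^ 2 + (9 / 2 - |3 * (r + s) + n| / 2) ^ 2 / 3 ≤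
      (2 * x + r - 1 / 2) ^ 2 + 27 / 4 +
        (s ^ 2 - (Y - x + 4 - 2 * r) * s + n ^ 2 / 3 - (2 - Y + x) * n) := by
    have h1 := sub_abs_sq_le_sub (c := 9 / 2) (t := (3 * (r + s) + n) / 2) (by norm_num)
    rw [abs_div, abs_two] at h1
    refine (add_le_add_right (div_le_div_of_nonneg_right h1 (by norm_num)) _).trans (le_of_eq ?_)
    linear_combination -hm
  rcases le_or_gt 0 n with hn | hn
  · right
    refine m2.trans_lt ?_
    have e1 : 0 < s * (Y - x + 4 - 2 * r - s) := mul_pos hs (by linarith)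
    have e2 : 0 ≤ n * (2 - Y + x - n / 3) := mul_nonneg hn (by linarith)
    linarith
  · obtain ⟨t, rfl⟩ : ∃ t, n = -t := ⟨-n, by ring⟩
    have ht : 0 < t := by linarith
    have hst : s + t ≤ 1 - x + Y - r := by linarith
    -- The face condition replaces s² and t² by linear terms minus st; the resulting -(4/3)st yields
    -- strictness.
    have q1 : 0 ≤ s * (1 - x + Y - r - s - t) := mul_nonneg hs.le (by linarith)
    have q2 : 0 ≤ t * (1 - x + Y - r - s - t) := mul_nonneg ht.le (by linarith)
    have q3 : 0 < s * t := mul_pos hs ht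
    have hK' := mul_le_mul_of_nonneg_left hK ht.le
    have q4 : 0 < s * t * (3 * x + Y + 3) := mul_pos q3 hD
    rcases le_or_gt (s * (3 * x + Y + 3)) ((5 + x - Y) * t) with hc | hc
    · left
      rw [abs_neg, abs_of_pos ht]
      have e1 := mul_le_mul_of_nonneg_right hc (by linarith : 0 ≤ 3 * x + Y + r)
      have e2 : (s * (3 * x + Y + r) + t * ((1 - x + Y - r) / 3 - 3) - 4 / 3 * (s * t)) *
          (3 * x + Y + 3) < 0 := by linarith
      have e3 := neg_of_mul_neg_left e2 hD.le
      linarith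
    · right
      refine m2.trans_lt ?_
      have e1 := mul_le_mul_of_nonneg_right hc.le (by linarith : 0 ≤ 3 - r)
      have e2 : (-((3 - r) * s) + (2 + x - Y + (1 - x + Y - r) / 3) * t - 4 / 3 * (s * t)) *
          (3 * x + Y + 3) < 0 := by linarith
      have e3 := neg_of_mul_neg_left e2 hD.le
      linarith

/-- Beyond the candidate on the left, one of two developments gives a smaller distance. -/
theorem lt_of_lt_stepLeft {x Y e n : ℝ} (hT : InT x Y) (hF : InFace (x + e) (Y + n))
    (he : e < stepLeft x Y) :
    (2 * x + e - 1 / 2) ^ 2 + (9 / 2 - |n|) ^ 2 / 3 < heightSq x (stepLeft x Y) ∨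
      ((2 * Y + n - 2 * x - e - 1) / 2) ^ 2 + (9 / 2 - |3 * e + n| / 2) ^ 2 / 3 <
        heightSq x (stepLeft x Y) := by
  have hm := stepLeft_mul hT
  have hr0 := stepLeft_nonpos hT
  have hr1 := neg_stepLeft_le hT
  have hx0 := hT.x_nonneg
  have hx1 := hT.x_le_one
  have hY1 := hT.Y_le
  obtain ⟨hY0, hl, hr⟩ := hT
  obtain ⟨f1, f2, f3⟩ := hF
  set r := stepLeft x Y
  obtain ⟨s, rfl⟩ : ∃ s, e = r - s := ⟨r - e, by ring⟩
  have hs : 0 < s := by linarith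
  have hn : |n| ≤ 9 / 4 := abs_le.2 ⟨by linarith, by linarith⟩
  have hn0 := abs_nonneg n
  unfold heightSq
  -- On this side the estimates have slack, and the crude threshold s = |n| already separates the
  -- two developments.
  rcases le_or_gt s |n| with hc | hc
  · left
    have e1 : s * (s - 2 * r - 4 * x + 1) ≤ s * (7 / 4) :=
      mul_le_mul_of_nonneg_left (by linarith) hs.le
    have e2 : |n| * (|n| / 3 - 3) ≤ |n| * (-(9 / 4)) :=
      mul_le_mul_of_nonneg_left (by linarith) hn0
    linarith
  · right
    have h1 := sub_abs_sq_le_sub (c := 9 / 2) (t := -((3 * (r - s) + n) / 2)) (by norm_num)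
    rw [abs_neg, abs_div, abs_two] at h1
    have m2 : ((2 * Y + n - 2 * x - (r - s) - 1) / 2) ^ 2 +
        (9 / 2 - |3 * (r - s) + n| / 2) ^ 2 / 3 ≤ (2 * x + r - 1 / 2) ^ 2 + 27 / 4 +
        (s ^ 2 - (5 - Y + x + 2 * r) * s + n ^ 2 / 3 + (1 + Y - x) * n) := by
      refine (add_le_add_right (div_le_div_of_nonneg_right h1 (by norm_num)) _).trans (le_of_eq ?_)
      linear_combination hm
    refine m2.trans_lt ?_
    have e1 : s * (s - 5 + Y - x - 2 * r) ≤ s * (-(7 / 2)) :=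
      mul_le_mul_of_nonneg_left (by linarith) hs.le
    have e2 : (1 + Y - x) * n ≤ (1 + Y - x) * |n| :=
      mul_le_mul_of_nonneg_left (le_abs_self n) (by linarith)
    have e3 : |n| * (|n| / 3 + 1 + Y - x) ≤ |n| * (5 / 2) :=
      mul_le_mul_of_nonneg_left (by linarith) hn0
    have e4 : n ^ 2 = |n| * |n| := by rw [← sq, sq_abs]
    linarith

theorem lt_or_eq_of_inFace {x Y e n R : ℝ} (hT : InT x Y) (hF : InFace (x + e) (Y + n))
    (hR : heightSq x (stepRight x Y) ≤ R) (hR' : heightSq x (stepLeft x Y) ≤ R) :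
    (2 * x + e - 1 / 2) ^ 2 + (9 / 2 - |n|) ^ 2 / 3 < R ∨
      ((2 * Y + n - 2 * x - e - 1) / 2) ^ 2 + (9 / 2 - |3 * e + n| / 2) ^ 2 / 3 < R ∨
      (n = 0 ∧ (e = stepRight x Y ∨ e = stepLeft x Y)) := by
  rcases lt_or_ge (stepRight x Y) e with h1 | h1
  · rcases lt_of_stepRight_lt hT hF h1 with h | h
    · exact Or.inl (h.trans_le hR)
    · exact Or.inr (Or.inl (h.trans_le hR))
  rcases lt_or_ge e (stepLeft x Y) with h2 | h2
  · rcases lt_of_lt_stepLeft hT hF h2 with h | h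
    · exact Or.inl (h.trans_le hR')
    · exact Or.inr (Or.inl (h.trans_le hR'))
  have k1 : (2 * x - 1 / 2 + stepLeft x Y) ^ 2 ≤ R - 27 / 4 := by
    unfold heightSq at hR'; linarith
  have k2 : (2 * x - 1 / 2 + stepRight x Y) ^ 2 ≤ R - 27 / 4 := by
    unfold heightSq at hR; linarith
  by_cases hn : n = 0
  · subst hn
    by_cases e1 : e = stepRight x Y
    · exact Or.inr (Or.inr ⟨rfl, Or.inl e1⟩)
    by_cases e2 : e = stepLeft x Y
    · exact Or.inr (Or.inr ⟨rfl, Or.inr e2⟩)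
    left
    have := sq_lt_of_between (lt_of_le_of_ne h2 (Ne.symm e2)) (lt_of_le_of_ne h1 e1) k1 k2
    rw [abs_zero]
    linarith
  · left
    have := sq_le_of_between h2 h1 k1 k2
    have hn0 : 0 < |n| := abs_pos.2 hn
    have hx0 := hT.x_nonneg
    have hY1 := hT.Y_le
    obtain ⟨hY0, hl, hr⟩ := hT
    obtain ⟨f1, f2, f3⟩ := hF
    have hn1 : |n| ≤ 9 / 4 := abs_le.2 ⟨by linarith, by linarith⟩
    have : 0 < |n| * (9 - |n|) := mul_pos hn0 (by linarith)
    linarith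

/-! ### Distances from a point of `T` -/

theorem surfaceDist_antipode_le {x Y e n : ℝ} (h : InFace x Y) (h' : InFace (x + e) (Y + n)) :
    surfaceDist (facePoint x Y) (antipode (facePoint (x + e) (Y + n))) ≤
        ENNReal.ofReal √((2 * x + e - 1 / 2) ^ 2 + (9 / 2 - |n|) ^ 2 / 3) ∧
      surfaceDist (facePoint x Y) (antipode (facePoint (x + e) (Y + n))) ≤
        ENNReal.ofReal √(((2 * Y + n - 2 * x - e - 1) / 2) ^ 2 +
          (9 / 2 - |3 * e + n| / 2) ^ 2 / 3) := by
  rw [facePoint_eq h, facePoint_eq h', antipode_oct]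
  obtain ⟨f1, f2, f3⟩ := h
  obtain ⟨g1, g2, g3⟩ := h'
  constructor
  · refine (surfaceDist_le_opposite_left (by linarith) (by linarith) (by linarith) (by linarith)
      (by linarith) (by linarith) _ _).trans (le_of_eq ?_)
    have : |(1 - (x + e) - (Y + n)) / 3 - (1 - (x + e) + (Y + n)) / 3 -
        ((1 - x - Y) / 3 - (1 - x + Y) / 3)| = 2 / 3 * |n| := by
      rw [← abs_neg, ← abs_of_pos (by norm_num : (0 : ℝ) < 2 / 3), ← abs_mul]
      congr 1; ring
    rw [this]
    congr 2; ring
  · refine (surfaceDist_le_opposite_mid (by linarith) (by linarith) (by linarith) (by linarith)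
      (by linarith) (by linarith) _ _).trans (le_of_eq ?_)
    have : |(1 - (x + e) - (Y + n)) / 3 - (1 + 2 * (x + e)) / 3 -
        ((1 - x - Y) / 3 - (1 + 2 * x) / 3)| = 1 / 3 * |3 * e + n| := by
      rw [← abs_neg, ← abs_of_pos (by norm_num : (0 : ℝ) < 1 / 3), ← abs_mul]
      congr 1; ring
    rw [this]
    congr 2; ring

theorem surfaceDist_antipode_eq {x Y e : ℝ} (hY : 0 ≤ Y) (h : InFace x Y) (h' : InFace (x + e) Y)
    (he : heightSq x e ≤ ((2 * Y - 2 * x - e - 1) / 2) ^ 2 + (9 / 2 - |3 * e| / 2) ^ 2 / 3) :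
    surfaceDist (facePoint x Y) (antipode (facePoint (x + e) Y)) =
      ENNReal.ofReal √(heightSq x e) := by
  have h'' : InFace (x + e) (Y + 0) := by rwa [add_zero]
  refine le_antisymm ?_ ?_
  · have := (surfaceDist_antipode_le h h'').1
    rw [add_zero, abs_zero] at this
    refine this.trans (le_of_eq ?_)
    rw [heightSq]
    congr 2; ring
  · rw [facePoint_eq h, facePoint_eq h', antipode_oct]
    obtain ⟨f1, f2, f3⟩ := h
    obtain ⟨g1, g2, g3⟩ := h'
    have a1 : |(1 - (x + e) - Y) / 3 - (1 - (x + e) + Y) / 3 -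
        ((1 - x - Y) / 3 - (1 - x + Y) / 3)| = 0 := by
      rw [abs_eq_zero]; ring
    have a2 : |(1 - (x + e) - Y) / 3 - (1 + 2 * (x + e)) / 3 -
        ((1 - x - Y) / 3 - (1 + 2 * x) / 3)| = 1 / 3 * |3 * e| := by
      rw [← abs_neg, ← abs_of_pos (by norm_num : (0 : ℝ) < 1 / 3), ← abs_mul]
      congr 1; ring
    have a3 : |(1 - (x + e) + Y) / 3 - (1 + 2 * (x + e)) / 3 -
        ((1 - x + Y) / 3 - (1 + 2 * x) / 3)| = 1 / 3 * |3 * e| := by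
      rw [← abs_neg, ← abs_of_pos (by norm_num : (0 : ℝ) < 1 / 3), ← abs_mul]
      congr 1; ring
    refine le_surfaceDist_opposite (by linarith) (by linarith) (by linarith) (by linarith)
      (by linarith) (by linarith) _ _ ?_ ?_ ?_
    · rw [a1, heightSq]
      exact le_of_eq (by ring)
    · rw [a2]
      exact he.trans (le_of_eq (by ring))
    · rw [a3]
      -- The third development exceeds the second by a multiple of this product, so for Y ≥ 0 it
      -- never decides the minimum.
      have := mul_nonneg hY (by linarith : 0 ≤ 2 * x + e + 1)
      refine he.trans ?_
      linarith

theorem surfaceDist_stepRight {x Y : ℝ} (hT : InT x Y) :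
    surfaceDist (facePoint x Y) (antipode (facePoint (x + stepRight x Y) Y)) =
      ENNReal.ofReal √(heightSq x (stepRight x Y)) := by
  refine surfaceDist_antipode_eq hT.nonneg hT.inFace hT.stepRight.inFace (le_of_eq ?_)
  rw [abs_of_nonneg (by linarith [stepRight_nonneg hT]), heightSq]
  linear_combination stepRight_mul hT

theorem surfaceDist_stepLeft {x Y : ℝ} (hT : InT x Y) :
    surfaceDist (facePoint x Y) (antipode (facePoint (x + stepLeft x Y) Y)) =
      ENNReal.ofReal √(heightSq x (stepLeft x Y)) := by
  refine surfaceDist_antipode_eq hT.nonneg hT.inFace hT.stepLeft.inFace (le_of_eq ?_)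
  rw [abs_of_nonpos (by linarith [stepLeft_nonpos hT]), heightSq]
  linear_combination -stepLeft_mul hT

theorem heightSq_pos (x e : ℝ) : 0 < heightSq x e := by unfold heightSq; positivity

theorem surfaceDist_lt_of_ne {x Y R : ℝ} (hT : InT x Y) (hR : heightSq x (stepRight x Y) ≤ R)
    (hR' : heightSq x (stepLeft x Y) ≤ R) {q : Octahedron}
    (hq : q ≠ antipode (facePoint (x + stepRight x Y) Y))
    (hq' : q ≠ antipode (facePoint (x + stepLeft x Y) Y)) :
    surfaceDist (facePoint x Y) q < ENNReal.ofReal √R := by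
  have hpos : 0 < R := (heightSq_pos _ _).trans_le hR
  obtain ⟨a, b, d, h, rfl⟩ := exists_oct q
  by_cases hp : 0 < a ∨ 0 < b ∨ 0 < d
  · refine surfaceDist_lt_of_not_opposite hT h hp (le_trans ?_ hR) fun hx => le_trans ?_ hR
    · unfold heightSq; linarith [sq_nonneg (2 * x + stepRight x Y - 1 / 2)]
    · unfold heightSq
      have h0 := stepRight_nonneg hT
      have : (2 * x - 1 / 2) ^ 2 ≤ (2 * x + stepRight x Y - 1 / 2) ^ 2 :=
        pow_le_pow_left₀ (by linarith) (by linarith) 2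
      linarith
  · simp only [not_or, not_lt] at hp
    obtain ⟨ha, hb, hd⟩ := hp
    have s := h
    rw [abs_of_nonpos ha, abs_of_nonpos hb, abs_of_nonpos hd] at s
    -- The displacement is read off from the face coordinates of the antipode of `q`.
    obtain ⟨e, he⟩ : ∃ e, x + e = (-3 * a - 1) / 2 := ⟨(-3 * a - 1) / 2 - x, by ring⟩
    obtain ⟨n, hn⟩ : ∃ n, Y + n = 3 * (d - b) / 2 := ⟨3 * (d - b) / 2 - Y, by ring⟩
    have hF : InFace (x + e) (Y + n) := by
      rw [he, hn]; constructor <;> linarith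
    have hqe : oct a b d h = antipode (facePoint (x + e) (Y + n)) := by
      rw [facePoint_eq hF, antipode_oct, oct_inj, he, hn]
      refine ⟨by linarith, by linarith, by linarith⟩
    rw [hqe] at hq hq' ⊢
    obtain ⟨u1, u2⟩ := surfaceDist_antipode_le hT.inFace hF
    rcases lt_or_eq_of_inFace hT hF hR hR' with h | h | ⟨h0, h | h⟩
    · exact lt_ofReal_sqrt u1 h hpos
    · exact lt_ofReal_sqrt u2 h hpos
    · exact absurd (by rw [h0, h, add_zero]) hq
    · exact absurd (by rw [h0, h, add_zero]) hq'

/-! ### The farthest points -/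

theorem ofReal_sqrt_heightSq_lt {x e e' : ℝ} (h : heightSq x e < heightSq x e') :
    ENNReal.ofReal √(heightSq x e) < ENNReal.ofReal √(heightSq x e') :=
  lt_ofReal_sqrt le_rfl h (heightSq_pos _ _)

theorem farthestSet_of_left_lt_right {x Y : ℝ} (hT : InT x Y)
    (h : heightSq x (stepLeft x Y) < heightSq x (stepRight x Y)) :
    farthestSet surfaceDist (facePoint x Y) = {antipode (facePoint (x + stepRight x Y) Y)} := by
  have key : ∀ q, q ≠ antipode (facePoint (x + stepRight x Y) Y) →
      surfaceDist (facePoint x Y) q <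
        surfaceDist (facePoint x Y) (antipode (facePoint (x + stepRight x Y) Y)) := by
    intro q hq
    rw [surfaceDist_stepRight hT]
    by_cases hq' : q = antipode (facePoint (x + stepLeft x Y) Y)
    · rw [hq', surfaceDist_stepLeft hT]
      exact ofReal_sqrt_heightSq_lt h
    · exact surfaceDist_lt_of_ne hT le_rfl h.le hq hq'
  ext q
  rw [Set.mem_singleton_iff]
  constructor
  · intro hq
    by_contra hne
    exact absurd (hq _) (not_le.2 (key q hne))
  · rintro rfl q'
    by_cases h' : q' = antipode (facePoint (x + stepRight x Y) Y)
    · rw [h']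
    · exact (key q' h').le

theorem farthestSet_of_right_lt_left {x Y : ℝ} (hT : InT x Y)
    (h : heightSq x (stepRight x Y) < heightSq x (stepLeft x Y)) :
    farthestSet surfaceDist (facePoint x Y) = {antipode (facePoint (x + stepLeft x Y) Y)} := by
  have key : ∀ q, q ≠ antipode (facePoint (x + stepLeft x Y) Y) →
      surfaceDist (facePoint x Y) q <
        surfaceDist (facePoint x Y) (antipode (facePoint (x + stepLeft x Y) Y)) := by
    intro q hq
    rw [surfaceDist_stepLeft hT]
    by_cases hq' : q = antipode (facePoint (x + stepRight x Y) Y)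
    · rw [hq', surfaceDist_stepRight hT]
      exact ofReal_sqrt_heightSq_lt h
    · exact surfaceDist_lt_of_ne hT h.le le_rfl hq' hq
  ext q
  rw [Set.mem_singleton_iff]
  constructor
  · intro hq
    by_contra hne
    exact absurd (hq _) (not_le.2 (key q hne))
  · rintro rfl q'
    by_cases h' : q' = antipode (facePoint (x + stepLeft x Y) Y)
    · rw [h']
    · exact (key q' h').le

theorem farthestSet_of_eq {x Y : ℝ} (hT : InT x Y)
    (h : heightSq x (stepRight x Y) = heightSq x (stepLeft x Y)) :
    farthestSet surfaceDist (facePoint x Y) =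
      {antipode (facePoint (x + stepRight x Y) Y), antipode (facePoint (x + stepLeft x Y) Y)} := by
  have h1 := surfaceDist_stepRight hT
  have h2 := surfaceDist_stepLeft hT
  rw [← h] at h2
  have key : ∀ q, surfaceDist (facePoint x Y) q ≤ ENNReal.ofReal √(heightSq x (stepRight x Y)) := by
    intro q
    by_cases hq : q = antipode (facePoint (x + stepRight x Y) Y)
    · rw [hq, h1]
    by_cases hq' : q = antipode (facePoint (x + stepLeft x Y) Y)
    · rw [hq', h2]
    exact (surfaceDist_lt_of_ne hT le_rfl h.ge hq hq').le
  ext q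
  rw [Set.mem_insert_iff, Set.mem_singleton_iff]
  constructor
  · intro hq
    by_contra! hne
    have h3 := surfaceDist_lt_of_ne hT le_rfl h.ge hne.1 hne.2
    rw [← h1] at h3
    exact absurd (hq _) (not_le.2 h3)
  · rintro (rfl | rfl) q'
    · rw [h1]; exact key q'
    · rw [h2]; exact key q'

/-- The function whose zero set is the curve `J`. -/
noncomputable def curveJ (x Y : ℝ) : ℝ := (1 - x - Y) ^ 3 - (2 + x) * (5 - 2 * x) * (1 - 4 * x)

/-- A difference of squares: cleared of denominators, the difference of the two steps is nine times
the product, and the other factor is twice `curveJ`. This is where the equation of J comes from. -/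
theorem heightSq_sub {x Y : ℝ} (hT : InT x Y) :
    (heightSq x (stepRight x Y) - heightSq x (stepLeft x Y)) *
        ((3 * x + Y + 3) * (6 - 3 * x - Y)) ^ 2 =
      18 * ((3 * x - Y) * (1 - x - Y)) * curveJ x Y := by
  have h1 := stepRight_mul hT
  have h2 := stepLeft_mul hT
  have e1 : (stepRight x Y - stepLeft x Y) * ((3 * x + Y + 3) * (6 - 3 * x - Y)) =
      9 * ((3 * x - Y) * (1 - x - Y)) := by
    linear_combination (6 - 3 * x - Y) * h1 - (3 * x + Y + 3) * h2
  have e2 : (4 * x - 1 + stepRight x Y + stepLeft x Y) * ((3 * x + Y + 3) * (6 - 3 * x - Y)) =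
      2 * curveJ x Y := by
    unfold curveJ
    linear_combination (6 - 3 * x - Y) * h1 + (3 * x + Y + 3) * h2
  unfold heightSq
  linear_combination (4 * x - 1 + stepRight x Y + stepLeft x Y) *
    ((3 * x + Y + 3) * (6 - 3 * x - Y)) * e1 + 9 * ((3 * x - Y) * (1 - x - Y)) * e2

theorem denominator_sq_pos {x Y : ℝ} (hT : InT x Y) :
    0 < ((3 * x + Y + 3) * (6 - 3 * x - Y)) ^ 2 := by
  have h1 : 0 < 3 * x + Y + 3 := by linarith [hT.x_nonneg, hT.nonneg]
  have h2 : 0 < 6 - 3 * x - Y := by linarith [hT.x_le_one, hT.right]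
  positivity

theorem farpointMap_eq {X : Type*} {d : X → X → ℝ≥0∞} {p q : X} (h : farthestSet d p = {q}) :
    farpointMap d p = q := by
  have h' : ∃ q, farthestSet d p = {q} := ⟨q, h⟩
  rw [farpointMap, dif_pos h']
  exact Set.singleton_injective (h'.choose_spec.symm.trans h)

theorem antipode_antipode (p : Octahedron) : antipode (antipode p) = p :=
  Subtype.ext (neg_neg p.1)

theorem stepRight_eq_zero {x Y : ℝ} (h : (3 * x - Y) * (1 - x - Y) = 0) : stepRight x Y = 0 := by
  rw [stepRight, h, zero_div]

theorem stepLeft_eq_zero {x Y : ℝ} (h : (3 * x - Y) * (1 - x - Y) = 0) : stepLeft x Y = 0 := by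
  rw [stepLeft, h, zero_div, neg_zero]

theorem farthestSet_right {x Y : ℝ} (hT : InT x Y)
    (h : 0 < curveJ x Y ∨ (3 * x - Y) * (1 - x - Y) = 0) :
    farthestSet surfaceDist (facePoint x Y) = {antipode (facePoint (x + stepRight x Y) Y)} := by
  by_cases h0 : (3 * x - Y) * (1 - x - Y) = 0
  · rw [farthestSet_of_eq hT (by rw [stepRight_eq_zero h0, stepLeft_eq_zero h0]),
      stepRight_eq_zero h0, stepLeft_eq_zero h0, Set.pair_eq_singleton]
  · have hpos := lt_of_le_of_ne hT.prod_nonneg (Ne.symm h0)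
    have hJ := h.resolve_right h0
    refine farthestSet_of_left_lt_right hT ?_
    have := heightSq_sub hT ▸ (by positivity : 0 < 18 * ((3 * x - Y) * (1 - x - Y)) * curveJ x Y)
    linarith [pos_of_mul_pos_left this (denominator_sq_pos hT).le]

theorem farthestSet_left {x Y : ℝ} (hT : InT x Y)
    (h : curveJ x Y < 0 ∨ (3 * x - Y) * (1 - x - Y) = 0) :
    farthestSet surfaceDist (facePoint x Y) = {antipode (facePoint (x + stepLeft x Y) Y)} := by
  by_cases h0 : (3 * x - Y) * (1 - x - Y) = 0
  · rw [farthestSet_of_eq hT (by rw [stepRight_eq_zero h0, stepLeft_eq_zero h0]),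
      stepRight_eq_zero h0, stepLeft_eq_zero h0, Set.pair_eq_singleton]
  · have hpos := lt_of_le_of_ne hT.prod_nonneg (Ne.symm h0)
    have hJ := h.resolve_right h0
    refine farthestSet_of_right_lt_left hT ?_
    have h1 := heightSq_sub hT
    have h2 : 18 * ((3 * x - Y) * (1 - x - Y)) * curveJ x Y < 0 :=
      mul_neg_of_pos_of_neg (by linarith) hJ
    rw [← h1] at h2
    linarith [neg_of_mul_neg_left h2 (denominator_sq_pos hT).le]

theorem facePoint_notMem_uniqueFarSet {x Y : ℝ} (hT : InT x Y) (h : curveJ x Y = 0)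
    (h0 : (3 * x - Y) * (1 - x - Y) ≠ 0) : facePoint x Y ∉ uniqueFarSet surfaceDist := by
  rintro ⟨q, hq⟩
  have h1 := heightSq_sub hT
  rw [h, mul_zero, mul_eq_zero, sub_eq_zero] at h1
  rw [farthestSet_of_eq hT (h1.resolve_right (denominator_sq_pos hT).ne')] at hq
  have hpos := lt_of_le_of_ne hT.prod_nonneg (Ne.symm h0)
  have e : antipode (facePoint (x + stepRight x Y) Y) =
      antipode (facePoint (x + stepLeft x Y) Y) :=
    (Set.mem_singleton_iff.1 (hq ▸ Set.mem_insert _ _)).trans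
      (Set.mem_singleton_iff.1 (hq ▸ Set.mem_insert_of_mem _ rfl)).symm
  have e' := congrArg antipode e
  rw [antipode_antipode, antipode_antipode,
    facePoint_inj hT.stepRight.inFace hT.stepLeft.inFace] at e'
  have h2 := stepRight_mul hT
  have h3 := stepLeft_nonpos hT
  have h4 : stepRight x Y ≤ 0 := by linarith [e'.1]
  have h5 : stepRight x Y * (3 * x + Y + 3) ≤ 0 :=
    mul_nonpos_of_nonpos_of_nonneg h4 (by linarith [hT.x_nonneg, hT.nonneg])
  linarith

theorem f_right {x Y : ℝ} (hT : InT x Y) (h : 0 < curveJ x Y ∨ (3 * x - Y) * (1 - x - Y) = 0) :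
    f (facePoint x Y) = facePoint (x + stepRight x Y) Y := by
  rw [f, farpointMap_eq (farthestSet_right hT h), antipode_antipode]

theorem f_left {x Y : ℝ} (hT : InT x Y) (h : curveJ x Y < 0 ∨ (3 * x - Y) * (1 - x - Y) = 0) :
    f (facePoint x Y) = facePoint (x + stepLeft x Y) Y := by
  rw [f, farpointMap_eq (farthestSet_left hT h), antipode_antipode]

/-- The derivative in x is 39 + 12x - 24x² - 3(1 - x - Y)², positive for x and 1 - x - Y in [0, 1];
the proof uses the divided difference. Monotonicity keeps an orbit on its side of J. -/
theorem curveJ_mono {x x' Y : ℝ} (hT : InT x Y) (hT' : InT x' Y) (h : x ≤ x') :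
    curveJ x Y ≤ curveJ x' Y := by
  have a0 := hT.x_nonneg
  have b0 := hT'.x_nonneg
  have a1 := hT.x_le_one
  have b1 := hT'.x_le_one
  have y0 := hT.nonneg
  have a2 := hT.right
  have b2 := hT'.right
  have p1 : x * x ≤ 1 := mul_le_one₀ a1 a0 a1
  have p2 : x * x' ≤ 1 := mul_le_one₀ a1 b0 b1
  have p3 : x' * x' ≤ 1 := mul_le_one₀ b1 b0 b1
  have q1 : (1 - x - Y) * (1 - x - Y) ≤ 1 := mul_le_one₀ (by linarith) (by linarith) (by linarith)
  have q2 : (1 - x - Y) * (1 - x' - Y) ≤ 1 := mul_le_one₀ (by linarith) (by linarith) (by linarith)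
  have q3 : (1 - x' - Y) * (1 - x' - Y) ≤ 1 := mul_le_one₀ (by linarith) (by linarith) (by linarith)
  have := mul_nonneg (sub_nonneg.2 h) (by linarith : 0 ≤ 39 + 6 * (x + x') -
    8 * (x * x + x * x' + x' * x') - ((1 - x - Y) * (1 - x - Y) + (1 - x - Y) * (1 - x' - Y) +
      (1 - x' - Y) * (1 - x' - Y)))
  unfold curveJ
  linarith

/-! ### Symmetries and the farpoint map -/

section Equivariance

variable {X : Type*} {d : X → X → ℝ≥0∞}

theorem farthestSet_map (G : X ≃ X) (hG : ∀ p q, d (G p) (G q) = d p q) (p : X) :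
    farthestSet d (G p) = G '' farthestSet d p := by
  ext q
  obtain ⟨q, rfl⟩ := G.surjective q
  rw [G.injective.mem_set_image]
  constructor
  · intro h q'
    simpa only [hG] using h (G q')
  · intro h q'
    obtain ⟨q', rfl⟩ := G.surjective q'
    rw [hG, hG]
    exact h q'

theorem map_mem_uniqueFarSet (G : X ≃ X) (hG : ∀ p q, d (G p) (G q) = d p q) {p : X} :
    G p ∈ uniqueFarSet d ↔ p ∈ uniqueFarSet d := by
  constructor
  · rintro ⟨q, hq⟩
    obtain ⟨q, rfl⟩ := G.surjective q
    rw [farthestSet_map G hG, ← Set.image_singleton] at hq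
    exact ⟨q, G.injective.image_injective hq⟩
  · rintro ⟨q, hq⟩
    exact ⟨G q, by rw [farthestSet_map G hG, hq, Set.image_singleton]⟩

theorem farpointMap_map (G : X ≃ X) (hG : ∀ p q, d (G p) (G q) = d p q) (p : X) :
    farpointMap d (G p) = G (farpointMap d p) := by
  by_cases h : p ∈ uniqueFarSet d
  · obtain ⟨q, hq⟩ := h
    rw [farpointMap_eq hq]
    exact farpointMap_eq (by rw [farthestSet_map G hG, hq, Set.image_singleton])
  · have h' : G p ∉ uniqueFarSet d := fun hp => h ((map_mem_uniqueFarSet G hG).1 hp)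
    rw [farpointMap, dif_neg (show ¬∃ q, farthestSet d (G p) = {q} from h'), farpointMap,
      dif_neg (show ¬∃ q, farthestSet d p = {q} from h)]

theorem map_mem_orbitDomain (G : X ≃ X) (hG : ∀ p q, d (G p) (G q) = d p q) (n : ℕ) {p : X} :
    G p ∈ orbitDomain d n ↔ p ∈ orbitDomain d n := by
  induction n generalizing p with
  | zero => exact map_mem_uniqueFarSet G hG
  | succ n ih =>
    change (_ ∧ _) ↔ (_ ∧ _)
    rw [map_mem_uniqueFarSet G hG, farpointMap_map G hG, ih]

end Equivariance

theorem f_signedPerm (π : Equiv.Perm (Fin 3)) (ε : Fin 3 → ℤˣ) (p : Octahedron) :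
    f (signedPerm π ε p) = signedPerm π ε (f p) := by
  rw [f, f, signedPerm_antipode]
  congr 1
  exact farpointMap_map (signedPerm π ε).toEquiv (surfaceDist_isometryEquiv _) p

theorem antipode_mem_orbitDomain {n : ℕ} {p : Octahedron} :
    antipode p ∈ orbitDomain surfaceDist n ↔ p ∈ orbitDomain surfaceDist n := by
  rw [antipode_eq_signedPerm]
  exact map_mem_orbitDomain (signedPerm 1 fun _ => -1).toEquiv (surfaceDist_isometryEquiv _) n

/-! ### The regular part of `T` -/

/-- The points of `T` off the curve `J`. -/
def Regular (x Y : ℝ) : Prop :=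
  InT x Y ∧ (curveJ x Y ≠ 0 ∨ (3 * x - Y) * (1 - x - Y) = 0)

theorem Regular.cases {x Y : ℝ} (h : Regular x Y) :
    (0 < curveJ x Y ∨ (3 * x - Y) * (1 - x - Y) = 0) ∨
      (curveJ x Y < 0 ∨ (3 * x - Y) * (1 - x - Y) = 0) := by
  rcases h.2 with h | h
  · rcases lt_or_gt_of_ne h with h | h
    · exact Or.inr (Or.inl h)
    · exact Or.inl (Or.inl h)
  · exact Or.inl (Or.inr h)

theorem right_stepRight {x Y : ℝ} (hT : InT x Y)
    (h : 0 < curveJ x Y ∨ (3 * x - Y) * (1 - x - Y) = 0) :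
    0 < curveJ (x + stepRight x Y) Y ∨
      (3 * (x + stepRight x Y) - Y) * (1 - (x + stepRight x Y) - Y) = 0 := by
  rcases h with h | h
  · exact Or.inl (h.trans_le (curveJ_mono hT hT.stepRight (by linarith [stepRight_nonneg hT])))
  · right; rw [stepRight_eq_zero h, add_zero, h]

theorem left_stepLeft {x Y : ℝ} (hT : InT x Y)
    (h : curveJ x Y < 0 ∨ (3 * x - Y) * (1 - x - Y) = 0) :
    curveJ (x + stepLeft x Y) Y < 0 ∨
      (3 * (x + stepLeft x Y) - Y) * (1 - (x + stepLeft x Y) - Y) = 0 := by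
  rcases h with h | h
  · exact Or.inl ((curveJ_mono hT.stepLeft hT (by linarith [stepLeft_nonpos hT])).trans_lt h)
  · right; rw [stepLeft_eq_zero h, add_zero, h]

theorem Regular.mem_uniqueFarSet {x Y : ℝ} (h : Regular x Y) :
    facePoint x Y ∈ uniqueFarSet surfaceDist := by
  rcases h.cases with h' | h'
  · exact ⟨_, farthestSet_right h.1 h'⟩
  · exact ⟨_, farthestSet_left h.1 h'⟩

theorem Regular.exists_f_eq {x Y : ℝ} (h : Regular x Y) :
    ∃ x', Regular x' Y ∧ f (facePoint x Y) = facePoint x' Y := by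
  rcases h.cases with h' | h'
  · exact ⟨_, ⟨h.1.stepRight, (right_stepRight h.1 h').imp_left ne_of_gt⟩, f_right h.1 h'⟩
  · exact ⟨_, ⟨h.1.stepLeft, (left_stepLeft h.1 h').imp_left ne_of_lt⟩, f_left h.1 h'⟩

theorem Regular.mem_orbitDomain (n : ℕ) {x Y : ℝ} (h : Regular x Y) :
    facePoint x Y ∈ orbitDomain surfaceDist n := by
  induction n generalizing x with
  | zero => exact h.mem_uniqueFarSet
  | succ n ih =>
    refine ⟨h.mem_uniqueFarSet, ?_⟩
    obtain ⟨x', hx', hf⟩ := h.exists_f_eq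
    -- The orbit domains are invariant under the antipodal map, so `f` may replace the farpoint map.
    rw [← antipode_mem_orbitDomain]
    change f (facePoint x Y) ∈ _
    rw [hf]
    exact ih hx'

theorem facePoint_mem_uniqueFarSet_iff {x Y : ℝ} (hT : InT x Y) :
    facePoint x Y ∈ uniqueFarSet surfaceDist ↔ Regular x Y := by
  refine ⟨fun h => ⟨hT, ?_⟩, fun h => h.mem_uniqueFarSet⟩
  by_contra! hc
  exact facePoint_notMem_uniqueFarSet hT hc.1 hc.2 h

theorem f_eq_self_iff {x Y : ℝ} (h : Regular x Y) :
    f (facePoint x Y) = facePoint x Y ↔ (3 * x - Y) * (1 - x - Y) = 0 := by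
  constructor
  · intro hf
    rcases h.cases with h' | h'
    · rw [f_right h.1 h', facePoint_inj h.1.stepRight.inFace h.1.inFace] at hf
      rw [← stepRight_mul h.1, (by linarith [hf.1] : stepRight x Y = 0), zero_mul]
    · rw [f_left h.1 h', facePoint_inj h.1.stepLeft.inFace h.1.inFace] at hf
      rw [← neg_eq_zero, ← stepLeft_mul h.1, (by linarith [hf.1] : stepLeft x Y = 0), zero_mul]
  · intro h0
    rw [f_right h.1 (Or.inr h0), stepRight_eq_zero h0, add_zero]

/-! ### The sets `T`, `∂_∞ T` and `J` -/

theorem chart_eq (z : ℝ × ℝ) : chart z =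
    vec ((1 + 2 * z.1) / 3) ((1 - z.1 + √3 * z.2) / 3) ((1 - z.1 - √3 * z.2) / 3) := by
  have h : z.2 / √3 = √3 * z.2 / 3 := by
    rw [div_eq_div_iff (by positivity) (by norm_num)]
    linear_combination (-z.2) * Real.mul_self_sqrt (by norm_num : (0 : ℝ) ≤ 3)
  rw [chart, vec, h, add_div _ (√3 * z.2), sub_div _ (√3 * z.2)]

theorem mem_planeT_iff (z : ℝ × ℝ) : z ∈ planeT ↔ InT z.1 (√3 * z.2) := by
  have h3 : √3 * √3 = (3 : ℝ) := Real.mul_self_sqrt (by norm_num)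
  have h0 : 0 < √3 := by positivity
  constructor
  · intro hz
    have hconv : Convex ℝ {z : ℝ × ℝ | InT z.1 (√3 * z.2)} := by
      rintro u ⟨a1, a2, a3⟩ v ⟨b1, b2, b3⟩ s t hs ht hst
      simp only [Set.mem_ofPred_eq, Prod.fst_add, Prod.snd_add, Prod.smul_fst, Prod.smul_snd,
        smul_eq_mul]
      have c1 := mul_le_mul_of_nonneg_left a2 hs
      have c2 := mul_le_mul_of_nonneg_left b2 ht
      have c3 := mul_le_mul_of_nonneg_left a3 hs
      have c4 := mul_le_mul_of_nonneg_left b3 ht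
      have c5 := mul_nonneg hs a1
      have c6 := mul_nonneg ht b1
      constructor <;> linarith
    refine convexHull_min ?_ hconv hz
    rintro _ (rfl | rfl | rfl)
    · constructor <;> simp
    · constructor <;> simp
    · have : √3 * (√3 / 4) = 3 / 4 := by linarith
      constructor <;> simp only [this] <;> norm_num
  · rintro ⟨h1, h2, h4⟩
    have hc := convex_convexHull ℝ ({(0, 0), (1, 0), (1 / 4, √3 / 4)} : Set (ℝ × ℝ))
    have m1 : ((0, 0) : ℝ × ℝ) ∈ planeT := subset_convexHull ℝ _ (by simp)
    have m2 : ((1, 0) : ℝ × ℝ) ∈ planeT := subset_convexHull ℝ _ (by simp)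
    have m3 : ((1 / 4, √3 / 4) : ℝ × ℝ) ∈ planeT := subset_convexHull ℝ _ (by simp)
    -- The weights are the barycentric coordinates with respect to the three vertices of T.
    have := hc.sum_mem (t := Finset.univ)
      (w := ![1 - z.1 - √3 * z.2, z.1 - √3 * z.2 / 3, 4 * (√3 * z.2) / 3])
      (z := ![(0, 0), (1, 0), (1 / 4, √3 / 4)])
      (by
        intro i _
        fin_cases i
        · simp; linarith
        · simp; linarith
        · simp; linarith)
      (by simp [Fin.sum_univ_three]; ring)
      (by
        intro i _
        fin_cases i
        · exact m1
        · exact m2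
        · exact m3)
    rw [Fin.sum_univ_three] at this
    refine Set.mem_of_eq_of_mem ?_ this
    ext
    · simp; ring
    · simp
      linear_combination (-z.2 / 3) * h3

theorem mem_onOctahedron_iff {S : Set (ℝ × ℝ)} {x Y : ℝ} (h : InFace x Y) :
    facePoint x Y ∈ onOctahedron S ↔ (x, Y / √3) ∈ S := by
  have h0 : √3 ≠ (0 : ℝ) := by positivity
  change (facePoint x Y).1 ∈ chart '' S ↔ _
  rw [facePoint_eq h]
  constructor
  · rintro ⟨z, hz, e⟩
    rw [chart_eq] at e
    obtain ⟨e1, e2, e3⟩ := vec_inj.1 e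
    have : z = (x, Y / √3) := by
      ext
      · simp only; linarith
      · simp only
        rw [eq_div_iff h0]
        linarith
    rwa [this] at hz
  · intro hz
    refine ⟨_, hz, ?_⟩
    rw [chart_eq]
    simp only [mul_div_cancel₀ _ h0]
    rfl

theorem mem_T_iff (p : Octahedron) : p ∈ T ↔ ∃ x Y, InT x Y ∧ p = facePoint x Y := by
  constructor
  · rintro ⟨z, hz, e⟩
    have hT := (mem_planeT_iff z).1 hz
    refine ⟨z.1, √3 * z.2, hT, Subtype.ext ?_⟩
    rw [facePoint_eq hT.inFace, ← e, chart_eq]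
    rfl
  · rintro ⟨x, Y, hT, rfl⟩
    have h0 : √3 ≠ (0 : ℝ) := by positivity
    rw [T, mem_onOctahedron_iff hT.inFace, mem_planeT_iff]
    simpa only [mul_div_cancel₀ _ h0] using hT

theorem mem_sidesT_iff {x Y : ℝ} (hT : InT x Y) :
    facePoint x Y ∈ sidesT ↔ (3 * x - Y) * (1 - x - Y) = 0 := by
  have h0 : √3 ≠ (0 : ℝ) := by positivity
  have h3 : √3 * √3 = (3 : ℝ) := Real.mul_self_sqrt (by norm_num)
  have hY : Y = √3 * (Y / √3) := (mul_div_cancel₀ _ h0).symm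
  rw [sidesT, mem_onOctahedron_iff hT.inFace, planeSides, mul_eq_zero]
  obtain ⟨k1, k2, k3⟩ := hT
  constructor
  · rintro (⟨s, t, hs, ht, hst, e⟩ | ⟨s, t, hs, ht, hst, e⟩)
    · simp only [Prod.ext_iff, Prod.fst_add, Prod.snd_add, Prod.smul_fst, Prod.smul_snd,
        smul_eq_mul] at e
      left
      rw [hY, ← e.2, ← e.1]
      linear_combination (-t / 4) * h3
    · simp only [Prod.ext_iff, Prod.fst_add, Prod.snd_add, Prod.smul_fst, Prod.smul_snd,
        smul_eq_mul] at e
      right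
      rw [hY, ← e.2, ← e.1]
      linear_combination (-t / 4) * h3 - hst
  · rintro (h | h)
    · left
      refine ⟨1 - 4 * x, 4 * x, by linarith, by linarith, by ring, ?_⟩
      ext
      · simp; ring
      · simp only [Prod.snd_add, Prod.smul_snd, smul_eq_mul]
        rw [eq_div_iff h0]
        linear_combination x * h3 + h
    · right
      refine ⟨1 - 4 / 3 * (1 - x), 4 / 3 * (1 - x), by linarith, by linarith, by ring, ?_⟩
      ext
      · simp; ring
      · simp only [Prod.snd_add, Prod.smul_snd, smul_eq_mul]
        rw [eq_div_iff h0]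
        linear_combination (1 - x) / 3 * h3 + h

theorem exists_cubic_root : ∃ r : ℝ, 0 < r ∧ r < 1 / 4 ∧ r ^ 3 - r ^ 2 - 4 * r + 1 = 0 := by
  have hc : ContinuousOn (fun r : ℝ => r ^ 3 - r ^ 2 - 4 * r + 1) (Set.Icc 0 (1 / 4)) := by
    fun_prop
  obtain ⟨r, hr, e⟩ := intermediate_value_Icc' (by norm_num) hc
    (show (0 : ℝ) ∈ _ from ⟨by norm_num, by norm_num⟩)
  simp only at e
  refine ⟨r, lt_of_le_of_ne hr.1 ?_, lt_of_le_of_ne hr.2 ?_, e⟩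
  · rintro rfl; norm_num at e
  · rintro rfl; norm_num at e

/-- The number r is where `curveJ` meets Y = 0, since `curveJ x 0` = -9(x³ - x² - 4x + 1). On T the
condition Y ≥ 0 then becomes r ≤ x, and the sides are excluded by x < 1/4. -/
theorem mem_J_iff {x Y : ℝ} (hT : InT x Y) :
    facePoint x Y ∈ J ↔ curveJ x Y = 0 ∧ (3 * x - Y) * (1 - x - Y) ≠ 0 := by
  have h0 : √3 ≠ (0 : ℝ) := by positivity
  have hx0 := hT.x_nonneg
  have hx1 := hT.x_le_one
  rw [J, mem_onOctahedron_iff hT.inFace]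
  obtain ⟨k1, k2, k3⟩ := hT
  constructor
  · rintro ⟨r, hr0, hr1, hr, hrx, hx4, e⟩
    simp only at hrx hx4 e
    have hg : 0 < (2 + x) * (5 - 2 * x) * (1 - 4 * x) :=
      mul_pos (mul_pos (by linarith) (by linarith)) (by linarith)
    rw [div_mul_eq_mul_div, one_mul, div_left_inj' h0] at e
    have hc : (((2 + x) * (5 - 2 * x) * (1 - 4 * x)) ^ (1 / 3 : ℝ)) ^ 3 =
        (2 + x) * (5 - 2 * x) * (1 - 4 * x) := by
      rw [← Real.rpow_natCast, ← Real.rpow_mul hg.le]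
      norm_num
    have hv : ((2 + x) * (5 - 2 * x) * (1 - 4 * x)) ^ (1 / 3 : ℝ) = 1 - x - Y := by linarith
    rw [hv] at hc
    refine ⟨by rw [curveJ, hc, sub_self], ?_⟩
    rw [mul_ne_zero_iff]
    constructor
    · intro h
      obtain rfl : Y = 3 * x := by linarith
      have h1 : (1 - 4 * x) * ((1 - 4 * x) ^ 2 - (2 + x) * (5 - 2 * x)) = 0 := by
        linear_combination hc
      have h2 : 0 < 1 - 4 * x := by linarith
      have h4 := (mul_eq_zero.1 h1).resolve_left h2.ne'
      nlinarith
    · intro h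
      rw [h] at hc
      norm_num at hc
      linarith
  · rintro ⟨hJ, hne⟩
    obtain ⟨-, hv⟩ := mul_ne_zero_iff.1 hne
    have hv0 : 0 < 1 - x - Y := lt_of_le_of_ne (by linarith) (Ne.symm hv)
    have hg : (2 + x) * (5 - 2 * x) * (1 - 4 * x) = (1 - x - Y) ^ 3 := by
      unfold curveJ at hJ; linarith
    have hx4 : x < 1 / 4 := by
      have : 0 < (2 + x) * (5 - 2 * x) * (1 - 4 * x) := hg ▸ pow_pos hv0 3
      have := pos_of_mul_pos_right this (mul_nonneg (by linarith) (by linarith))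
      linarith
    obtain ⟨r, hr0, hr1, hr⟩ := exists_cubic_root
    refine ⟨r, hr0, hr1, hr, ?_, hx4, ?_⟩
    · by_contra! hlt
      simp only at hlt
      have h1 : (1 - x - Y) ^ 3 ≤ (1 - x) ^ 3 := pow_le_pow_left₀ hv0.le (by linarith) 3
      have h2 : x ^ 3 - x ^ 2 - 4 * x + 1 ≤ 0 := by rw [← hg] at h1; linarith
      have p1 : x * x ≤ 1 := mul_le_one₀ hx1 hx0 hx1
      have p2 : x * r ≤ 1 := mul_le_one₀ hx1 hr0.le (by linarith)
      have p3 : r * r ≤ 1 := mul_le_one₀ (by linarith) hr0.le (by linarith)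
      have := mul_pos (by linarith : 0 < r - x)
        (by linarith : 0 < 4 + x + r - (x * x + x * r + r * r))
      linarith
    · simp only
      rw [hg, div_mul_eq_mul_div, one_mul, div_left_inj' h0, ← Real.rpow_natCast,
        ← Real.rpow_mul hv0.le]
      norm_num

theorem notMem_J_iff {x Y : ℝ} (hT : InT x Y) : facePoint x Y ∉ J ↔ Regular x Y := by
  rw [mem_J_iff hT, Regular, not_and_or, not_ne_iff]
  exact ⟨fun h => ⟨hT, h⟩, fun h => h.2⟩

/-! ### Limits of orbits -/

theorem exists_signedPerm_mem_T (q : Octahedron) :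
    ∃ π : Equiv.Perm (Fin 3), ∃ ε : Fin 3 → ℤˣ, signedPerm π ε q ∈ T := by
  obtain ⟨π, hπ⟩ : ∃ π : Equiv.Perm (Fin 3), Antitone fun i => |q.1 (π i)| := by
    refine ⟨Tuple.sort (fun i => -|q.1 i|), fun i j hij => ?_⟩
    exact neg_le_neg_iff.1 (Tuple.monotone_sort (fun i => -|q.1 i|) hij)
  refine ⟨π, fun i => if 0 ≤ q.1 (π i) then 1 else -1, ?_⟩
  have habs : ∀ i, (signedPerm π (fun i => if 0 ≤ q.1 (π i) then 1 else -1) q).1 i =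
      |q.1 (π i)| := by
    intro i
    rw [signedPerm_apply]
    split_ifs with h
    · simp [abs_of_nonneg h]
    · simp [abs_of_neg (not_le.1 h)]
  obtain ⟨a, b, d, h, e⟩ := exists_oct (signedPerm π (fun i => if 0 ≤ q.1 (π i) then 1 else -1) q)
  rw [e] at habs ⊢
  have hc := sqrt_three_halves_pos
  have h0 := habs 0
  have h1 := habs 1
  have h2 := habs 2
  simp only [oct, vec_zero, vec_one, vec_two] at h0 h1 h2
  have l1 := hπ (show (0 : Fin 3) ≤ 1 by decide)
  have l2 := hπ (show (1 : Fin 3) ≤ 2 by decide)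
  simp only [← h0, ← h1, ← h2] at l1 l2
  have l3 : b ≤ a := le_of_mul_le_mul_left l1 hc
  have l4 : d ≤ b := le_of_mul_le_mul_left l2 hc
  have l5 : 0 ≤ d := nonneg_of_mul_nonneg_right (h2 ▸ abs_nonneg _) hc
  have s := h
  rw [abs_of_nonneg (by linarith), abs_of_nonneg (by linarith), abs_of_nonneg l5] at s
  have hT : InT ((3 * a - 1) / 2) (3 * (b - d) / 2) := by constructor <;> linarith
  rw [mem_T_iff]
  refine ⟨_, _, hT, ?_⟩
  rw [facePoint_eq hT.inFace, oct_inj]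
  refine ⟨by ring, by linarith, by linarith⟩

theorem InT.antitone {x Y : ℝ} (hT : InT x Y) : Antitone fun i => (facePoint x Y).1 i := by
  have hc := sqrt_three_halves_pos
  obtain ⟨h1, h2, h3⟩ := id hT
  rw [facePoint_eq hT.inFace]
  refine antitone_iff_forall_lt.2 fun i j hij => ?_
  simp only [oct]
  fin_cases i <;> fin_cases j <;> first | exact absurd hij (by decide) | skip
  · change vec _ _ _ 1 ≤ vec _ _ _ 0
    rw [vec_zero, vec_one]
    exact mul_le_mul_of_nonneg_left (by linarith) hc.le
  · change vec _ _ _ 2 ≤ vec _ _ _ 0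
    rw [vec_zero, vec_two]
    exact mul_le_mul_of_nonneg_left (by linarith) hc.le
  · change vec _ _ _ 2 ≤ vec _ _ _ 1
    rw [vec_one, vec_two]
    exact mul_le_mul_of_nonneg_left (by linarith) hc.le

theorem InT.coord_nonneg {x Y : ℝ} (hT : InT x Y) (i : Fin 3) : 0 ≤ (facePoint x Y).1 i := by
  refine le_trans ?_ (hT.antitone (show i ≤ 2 from Fin.le_last i))
  rw [facePoint_eq hT.inFace]
  exact (vec_sign_iff _ _ _).2.2.2.2.1.2 (by linarith [hT.right])

/-- Points of T have nonnegative, decreasing coordinates, and a decreasing rearrangement is unique.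
-/
theorem signedPerm_eq_self {π : Equiv.Perm (Fin 3)} {ε : Fin 3 → ℤˣ} {p : Octahedron}
    (h : p ∈ T) (h' : signedPerm π ε p ∈ T) : signedPerm π ε p = p := by
  obtain ⟨x, Y, hT, rfl⟩ := (mem_T_iff _).1 h
  obtain ⟨x', Y', hT', e⟩ := (mem_T_iff _).1 h'
  have hc : ∀ i, (signedPerm π ε (facePoint x Y)).1 i = (facePoint x Y).1 (π i) := by
    intro i
    have h1 := hT.coord_nonneg (π i)
    have h2 : 0 ≤ (signedPerm π ε (facePoint x Y)).1 i := by rw [e]; exact hT'.coord_nonneg i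
    rw [signedPerm_apply] at h2 ⊢
    rcases Int.units_eq_one_or (ε i) with h3 | h3
    · simp [h3]
    · rw [h3] at h2 ⊢
      push_cast at h2 ⊢
      linarith
  have hanti : Antitone ((fun i => (facePoint x Y).1 i) ∘ π) := by
    have := hT'.antitone
    rw [← e] at this
    simp only [hc] at this
    exact this
  have heq : (fun i => (facePoint x Y).1 i) ∘ π = fun i => (facePoint x Y).1 i := by
    exact Tuple.unique_antitone (τ := 1) hanti hT.antitone
  apply Subtype.ext
  ext i
  rw [hc]
  exact congrFun heq i

/-- Points of an orbit on a horizontal line converge only to fixed points. -/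
theorem prod_eq_zero_of_tendsto {u : ℕ → ℝ} {x Y : ℝ} (hT : ∀ n, InT (u n) Y)
    (hu : (∀ n, u (n + 1) = u n + stepRight (u n) Y) ∨ (∀ n, u (n + 1) = u n + stepLeft (u n) Y))
    (hx : Tendsto u atTop (𝓝 x)) : (3 * x - Y) * (1 - x - Y) = 0 := by
  have hd : Tendsto (fun n => u (n + 1) - u n) atTop (𝓝 0) := by
    have := (hx.comp (tendsto_add_atTop_nat 1)).sub hx
    simpa using this
  have hp : Tendsto (fun n => (3 * u n - Y) * (1 - u n - Y)) atTop
      (𝓝 ((3 * x - Y) * (1 - x - Y))) :=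
    ((hx.const_mul 3).sub_const Y).mul ((hx.const_sub 1).sub_const Y)
  rcases hu with hu | hu
  · have h1 : Tendsto (fun n => (u (n + 1) - u n) * (3 * u n + Y + 3)) atTop
        (𝓝 (0 * (3 * x + Y + 3))) := hd.mul (((hx.const_mul 3).add_const Y).add_const 3)
    rw [zero_mul] at h1
    refine tendsto_nhds_unique hp (h1.congr fun n => ?_)
    rw [hu, add_sub_cancel_left, stepRight_mul (hT n)]
  · have h1 : Tendsto (fun n => -((u (n + 1) - u n) * (6 - 3 * u n - Y))) atTop
        (𝓝 (-(0 * (6 - 3 * x - Y)))) := (hd.mul (((hx.const_mul 3).const_sub 6).sub_const Y)).neg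
    rw [zero_mul, neg_zero] at h1
    refine tendsto_nhds_unique hp (h1.congr fun n => ?_)
    rw [hu, add_sub_cancel_left, stepLeft_mul (hT n), neg_neg]

theorem Regular.exists_orbit {x Y : ℝ} (h : Regular x Y) : ∃ u : ℕ → ℝ, (∀ n, InT (u n) Y) ∧
    (∀ n, f^[n] (facePoint x Y) = facePoint (u n) Y) ∧
    ((∀ n, u (n + 1) = u n + stepRight (u n) Y) ∨
      (∀ n, u (n + 1) = u n + stepLeft (u n) Y)) := by
  rcases h.cases with h' | h'
  · let u : ℕ → ℝ := fun n => (fun t => t + stepRight t Y)^[n] x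
    have hu : ∀ n, u (n + 1) = u n + stepRight (u n) Y :=
      fun n => Function.iterate_succ_apply' _ n x
    have key : ∀ n, InT (u n) Y ∧
        (0 < curveJ (u n) Y ∨ (3 * u n - Y) * (1 - u n - Y) = 0) := by
      intro n
      induction n with
      | zero => exact ⟨h.1, h'⟩
      | succ n ih => rw [hu]; exact ⟨ih.1.stepRight, right_stepRight ih.1 ih.2⟩
    refine ⟨u, fun n => (key n).1, fun n => ?_, Or.inl hu⟩
    induction n with
    | zero => rfl
    | succ n ih => rw [Function.iterate_succ_apply', ih, hu, f_right (key n).1 (key n).2]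
  · let u : ℕ → ℝ := fun n => (fun t => t + stepLeft t Y)^[n] x
    have hu : ∀ n, u (n + 1) = u n + stepLeft (u n) Y :=
      fun n => Function.iterate_succ_apply' _ n x
    have key : ∀ n, InT (u n) Y ∧
        (curveJ (u n) Y < 0 ∨ (3 * u n - Y) * (1 - u n - Y) = 0) := by
      intro n
      induction n with
      | zero => exact ⟨h.1, h'⟩
      | succ n ih => rw [hu]; exact ⟨ih.1.stepLeft, left_stepLeft ih.1 ih.2⟩
    refine ⟨u, fun n => (key n).1, fun n => ?_, Or.inr hu⟩
    induction n with
    | zero => rfl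
    | succ n ih => rw [Function.iterate_succ_apply', ih, hu, f_left (key n).1 (key n).2]

theorem Regular.limit_mem_sidesT {x Y : ℝ} (h : Regular x Y) {p : Octahedron}
    (hp : Tendsto (fun n : ℕ => surfaceDist (f^[n] (facePoint x Y)) p) atTop (𝓝 0)) :
    p ∈ sidesT := by
  obtain ⟨u, hT, hf, hu⟩ := h.exists_orbit
  -- The intrinsic distance dominates the Euclidean one, so the limit can be computed
  -- coordinatewise.
  have hlim : Tendsto (fun n => (facePoint (u n) Y : EuclideanSpace ℝ (Fin 3))) atTop
      (𝓝 (p : EuclideanSpace ℝ (Fin 3))) := by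
    rw [tendsto_iff_edist_tendsto_0]
    refine tendsto_of_tendsto_of_tendsto_of_le_of_le tendsto_const_nhds hp
      (fun _ => zero_le) fun n => ?_
    rw [← hf]
    exact edist_le_surfaceDist _ _
  obtain ⟨a, b, d, habd, rfl⟩ := exists_oct p
  have hc := sqrt_three_halves_pos
  have e : ∀ n, (facePoint (u n) Y : EuclideanSpace ℝ (Fin 3)) =
      vec ((1 + 2 * u n) / 3) ((1 - u n + Y) / 3) ((1 - u n - Y) / 3) := by
    intro n
    rw [facePoint_eq (hT n).inFace]
    rfl
  have coord : ∀ i, Tendsto (fun n => (facePoint (u n) Y).1 i) atTop (𝓝 (vec a b d i)) := by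
    intro i
    have hi : Continuous fun v : EuclideanSpace ℝ (Fin 3) => v i := by fun_prop
    exact (hi.tendsto _).comp hlim
  have h0 := coord 0
  have h1 := coord 1
  have h2 := coord 2
  simp only [e, vec_zero, vec_one, vec_two] at h0 h1 h2
  have hx : Tendsto u atTop (𝓝 ((3 * a - 1) / 2)) := by
    have := ((h0.const_mul ((√(3 / 2))⁻¹ * 3)).sub_const 1).div_const 2
    convert this using 2
    · field_simp; ring
    · field_simp
  set X := (3 * a - 1) / 2 with hX
  have hTX : InT X Y := by
    have h0 := hT 0
    refine ⟨h0.nonneg, ?_, ?_⟩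
    · exact ge_of_tendsto' (hx.const_mul 3) fun n => (hT n).left
    · exact le_of_tendsto' (hx.add_const Y) fun n => (hT n).right
  have hb : √(3 / 2) * b = √(3 / 2) * ((1 - X + Y) / 3) :=
    tendsto_nhds_unique h1 ((((hx.const_sub 1).add_const Y).div_const 3).const_mul _)
  have hd : √(3 / 2) * d = √(3 / 2) * ((1 - X - Y) / 3) :=
    tendsto_nhds_unique h2 ((((hx.const_sub 1).sub_const Y).div_const 3).const_mul _)
  have hp' : oct a b d habd = facePoint X Y := by
    rw [facePoint_eq hTX.inFace, oct_inj]
    exact ⟨by rw [hX]; ring, mul_left_cancel₀ hc.ne' hb, mul_left_cancel₀ hc.ne' hd⟩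
  rw [hp', mem_sidesT_iff hTX]
  exact prod_eq_zero_of_tendsto hT hu hx

theorem surfaceDist_self (p : Octahedron) : surfaceDist p p = 0 := by
  refine le_antisymm ((iInf_le _ (Path.refl p)).trans (le_of_eq ?_)) zero_le
  exact eVariationOn.constant_on (by simp)

theorem sidesT_subset_T : sidesT ⊆ T := by
  rintro p ⟨z, hz, e⟩
  refine ⟨z, ?_, e⟩
  have hc := convex_convexHull ℝ ({(0, 0), (1, 0), (1 / 4, √3 / 4)} : Set (ℝ × ℝ))
  rcases hz with hz | hz
  · exact hc.segment_subset (subset_convexHull ℝ _ (by simp)) (subset_convexHull ℝ _ (by simp)) hz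
  · exact hc.segment_subset (subset_convexHull ℝ _ (by simp)) (subset_convexHull ℝ _ (by simp)) hz

theorem fullOrbitDomain_subset : fullOrbitDomain surfaceDist ⊆ uniqueFarSet surfaceDist :=
  Set.iInter_subset (orbitDomain surfaceDist) 0

theorem limitSet_inter_T : limitSet ∩ T = sidesT := by
  ext p
  constructor
  · rintro ⟨⟨q, hq, hlim⟩, hp⟩
    obtain ⟨π, ε, hqT⟩ := exists_signedPerm_mem_T q
    have hlim' : Tendsto (fun n : ℕ => surfaceDist (f^[n] (signedPerm π ε q)) (signedPerm π ε p))
        atTop (𝓝 0) := by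
      refine hlim.congr fun n => ?_
      have : f^[n] (signedPerm π ε q) = signedPerm π ε (f^[n] q) :=
        ((Function.Semiconj.iterate_right (f := signedPerm π ε) (ga := f) (gb := f)
          (fun p => (f_signedPerm π ε p).symm) n).eq q).symm
      rw [this, surfaceDist_isometryEquiv]
    obtain ⟨x, Y, hT, e⟩ := (mem_T_iff _).1 hqT
    have hreg : Regular x Y := by
      rw [← facePoint_mem_uniqueFarSet_iff hT, ← e]
      exact (map_mem_uniqueFarSet (signedPerm π ε).toEquiv (surfaceDist_isometryEquiv _)).2
        (fullOrbitDomain_subset hq)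
    rw [e] at hlim'
    have hs := hreg.limit_mem_sidesT hlim'
    -- The moved limit lies on the sides, hence in T, as does `p`; so the symmetry fixes `p`.
    rwa [signedPerm_eq_self hp (sidesT_subset_T hs)] at hs
  · intro hp
    have hpT := sidesT_subset_T hp
    refine ⟨?_, hpT⟩
    obtain ⟨x, Y, hT, rfl⟩ := (mem_T_iff _).1 hpT
    have h0 := (mem_sidesT_iff hT).1 hp
    have hreg : Regular x Y := ⟨hT, Or.inr h0⟩
    refine ⟨_, Set.mem_iInter.2 fun n => hreg.mem_orbitDomain n, ?_⟩
    have hfix := (f_eq_self_iff hreg).2 h0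
    simp only [Function.iterate_fixed hfix, surfaceDist_self]
    exact tendsto_const_nhds

end Farpoint

theorem mainTheorem2 :
    (Farpoint.uniqueFarSet Farpoint.surfaceDist ∩ Farpoint.T = Farpoint.T \ Farpoint.J ∧
      Farpoint.fullOrbitDomain Farpoint.surfaceDist ∩ Farpoint.T = Farpoint.T \ Farpoint.J) ∧
    (∀ p ∈ Farpoint.T \ Farpoint.J, Farpoint.f p = p ↔ p ∈ Farpoint.sidesT) ∧
    Farpoint.limitSet ∩ Farpoint.T = Farpoint.sidesT := by
  refine ⟨⟨?_, ?_⟩, ?_, Farpoint.limitSet_inter_T⟩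
  · ext p
    constructor
    · rintro ⟨hu, hp⟩
      obtain ⟨x, Y, hT, rfl⟩ := (Farpoint.mem_T_iff _).1 hp
      exact ⟨hp, (Farpoint.notMem_J_iff hT).2 ((Farpoint.facePoint_mem_uniqueFarSet_iff hT).1 hu)⟩
    · rintro ⟨hp, hJ⟩
      obtain ⟨x, Y, hT, rfl⟩ := (Farpoint.mem_T_iff _).1 hp
      exact ⟨((Farpoint.notMem_J_iff hT).1 hJ).mem_uniqueFarSet, hp⟩
  · ext p
    constructor
    · rintro ⟨hu, hp⟩
      obtain ⟨x, Y, hT, rfl⟩ := (Farpoint.mem_T_iff _).1 hp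
      exact ⟨hp, (Farpoint.notMem_J_iff hT).2 ((Farpoint.facePoint_mem_uniqueFarSet_iff hT).1
        (Farpoint.fullOrbitDomain_subset hu))⟩
    · rintro ⟨hp, hJ⟩
      obtain ⟨x, Y, hT, rfl⟩ := (Farpoint.mem_T_iff _).1 hp
      exact ⟨Set.mem_iInter.2 fun n => ((Farpoint.notMem_J_iff hT).1 hJ).mem_orbitDomain n, hp⟩
  · rintro p ⟨hp, hJ⟩
    obtain ⟨x, Y, hT, rfl⟩ := (Farpoint.mem_T_iff _).1 hp
    rw [Farpoint.f_eq_self_iff ((Farpoint.notMem_J_iff hT).1 hJ), Farpoint.mem_sidesT_iff hT]
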